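/- \textbf{Setting.} Let $\mathcal G$ be an acyclic causal diagram (directed and bidirected edges) on finitely many observable variables $V_1,\dots,V_n$, each with a fixed finite domain of at least two values; $\mathbf{Pa}_i$ denotes the parents of $V_i$, and $\mathcal G[\mathbf W]$ the subgraph induced by $\mathbf W$. A set $\mathbf W$ is a single c-component if it is non-empty and $\mathcal G[\mathbf W]$ is connected by its bidirected edges. Models are structural causal models with mechanisms $V_i\gets f_i(\mathbf U_i,\mathbf{Pa}_i)$ and finitely many finite-domain latent variables that induce $\mathcal G$: $\mathbf U_i,\mathbf U_j$ are dependent if $V_i,V_j$ are joined by a bidirected edge, and $(\mathbf U_i)_{i\in A}$, $(\mathbf U_j)_{j\in B}$ are independent if $A,B$ are disjoint with no bidirected edge between them. All distributions are assumed positive: every event that is a conjunction of terms $V_{i[\mathbf{pa}_i]}=v_i$ and does not give two values to one potential response has positive probability. A ctf-factor is $Q[\mathbf W_\star](\mathbf w)=P(\mathbf W_\star=\mathbf w)$ for a finite set $\mathbf W_\star$ of potential responses $V_{i[\mathbf{pa}_i]}$ with values $\mathbf w$; $\mathbf V(\mathbf W_\star)$ is the set of variables occurring in it. For terms $V_{j[\mathbf{pa}_j]}=v_j$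 and $V_{i[\mathbf{pa}_i]}=v_i$, the first is \emph{chained} to the second if $V_j\in\mathbf{Pa}_i$ and $\mathbf{pa}_i$ assigns to $V_j$ the value $v_j$. The input $Q[\mathbf T_\star](\mathbf t)$ is known as a function of the values $\mathbf t$, where, as $\mathbf t$ varies, every subscript value that is chained from a term of $\mathbf T_\star=\mathbf t$ varies with it and all other subscript values stay fixed. $Q[\mathbf C_\star](\mathbf c)$ is \emph{identifiable} from $Q[\mathbf T_\star](\mathbf t)$ and $\mathcal G$ if any two positive models inducing $\mathcal G$ that agree on this function agree on the number $Q[\mathbf C_\star](\mathbf c)$. \textbf{Algorithm} $\textsc{identify}^+(\mathcal G,Q[\mathbf C_\star](\mathbf c),Q[\mathbf T_\star](\mathbf t))$. Let $\mathbf H_\star$ be the smallest set with $\mathbf C_\star\subseteq\mathbf H_\star\subseteq\mathbf T_\star$ such that no term of $\mathbf T_\star\setminus\mathbf H_\star$ is chained to a term of $\mathbf H_\star$. If $\mathbf H_\star=\mathbf C_\star$, return $\sum_{\mathbf t\setminus\mathbf c}Q[\mathbf T_\star](\mathbf t)$. Otherwise, if $\mathbf H_\star=\mathbf T_\star$, return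 FAIL. Otherwise put $Q[\mathbf H_\star](\mathbf h)=\sum_{\mathbf t\setminus\mathbf h}Q[\mathbf T_\star](\mathbf t)$, let $\mathbf H'_\star$ be the part of $\mathbf H_\star$ that belongs to the c-component of $\mathcal G[\mathbf V(\mathbf H_\star)]$ containing $\mathbf V(\mathbf C_\star)$, let $H_1<H_2<\cdots$ be any topological order of $\mathcal G[\mathbf V(\mathbf H_\star)]$, put $$Q[\mathbf H'_\star](\mathbf h')=\prod_{H_j\in\mathbf V(\mathbf H'_\star)}\frac{\sum_{h_k:\,k>j}Q[\mathbf H_\star](\mathbf h)}{\sum_{h_k:\,k\ge j}Q[\mathbf H_\star](\mathbf h)},$$ and return $\textsc{identify}^+(\mathcal G,Q[\mathbf C_\star](\mathbf c),Q[\mathbf H'_\star](\mathbf h'))$. \textbf{Ctf-hedge.} $\{\mathbf T_\star=\mathbf t\}$ is a ctf-hedge rooted in $\{\mathbf C_\star=\mathbf c\}\subsetneq\{\mathbf T_\star=\mathbf t\}$ if each variable appears at most once in $\mathbf T_\star$ and there is a graph $\mathcal G'$, obtained from $\mathcal G$ by deleting edges, such that, with $\mathbf T=\mathbf V(\mathbf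 T_\star)$ and $\mathbf C=\mathbf V(\mathbf C_\star)$: the bidirected edges of $\mathcal G'[\mathbf T]$ form a spanning tree of $\mathbf T$; every element of $\mathbf T$ is an ancestor of $\mathbf C$ in $\mathcal G'[\mathbf T]$; every vertex of $\mathcal G'[\mathbf T]$ has at most one child; and each term of $\mathbf T_\star\setminus\mathbf C_\star$ is chained to the term of its child in $\mathcal G'[\mathbf T]$. \textbf{Lemma ($\textsc{identify}^+$ soundness and completeness).} Let $Q[\mathbf T_\star](\mathbf t)$ be a ctf-factor in which each observable variable appears at most once and such that $\mathbf V(\mathbf T_\star)$ is a single c-component. Let $Q[\mathbf C_\star](\mathbf c)$ be a ctf-factor with $\mathbf C_\star\subseteq\mathbf T_\star$, $\mathbf c\subseteq\mathbf t$, such that $\mathbf V(\mathbf C_\star)$ is a single c-component. Then, whatever topological orders are used: (1) $Q[\mathbf C_\star](\mathbf c)$ is identifiable from $Q[\mathbf T_\star](\mathbf t)$ and $\mathcal G$ if and only if $\textsc{identify}^+$ returns an expression; (2) any expression returned equals $Q[\mathbf C_\star](\mathbf c)$ in every positive model inducing $\mathcal G$; (3) $\textsc{identify}^+$ returns FAIL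 if and only if one of its calls (the outermost included) has as its input event a ctf-hedge rooted in $\{\mathbf C_\star=\mathbf c\}$, and also if and only if some subset of the terms of $\{\mathbf T_\star=\mathbf t\}$ is such a ctf-hedge. -/

import Mathlib

noncomputable section CtfIdDefs

open Classical

namespace CtfId

/-! ### Causal diagrams, structural causal models, potential responses -/

/-- An acyclic causal diagram on the observable variables `V`: `dir j i` is a directed edge
`j → i`, and `bidir` holds the bidirected edges. -/
structure CausalDiagram (V : Type) where
  dir : V → V → Prop
  bidir : SimpleGraph V
  acyclic : ∀ v, ¬ Relation.TransGen dir v v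

theorem CausalDiagram.wf {V : Type} [Fintype V] (G : CausalDiagram V) : WellFounded G.dir := by
  have : Std.Irrefl (Relation.TransGen G.dir) := ⟨G.acyclic⟩
  exact Subrelation.wf (fun h => Relation.TransGen.single h)
    (Finite.wellFounded_of_trans_of_irrefl (Relation.TransGen G.dir))

/-- `G'` is obtained from `G` by deleting edges. -/
def CausalDiagram.IsSubgraph {V : Type} (G' G : CausalDiagram V) : Prop :=
  (∀ i j, G'.dir i j → G.dir i j) ∧ G'.bidir ≤ G.bidir

/-- `G[W]` is a single c-component: `W` is nonempty and any two of its elements are joined by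
a path of bidirected edges inside `W`. -/
def CausalDiagram.IsCComponent {V : Type} (G : CausalDiagram V) (W : Finset V) : Prop :=
  (G.bidir.induce (W : Set V)).Connected

/-- Assignments `pa_i` of values to the parents of `i`. -/
abbrev PaVal {V : Type} (G : CausalDiagram V) (Val : V → Type) (i : V) : Type :=
  (j : V) → G.dir j i → Val j

/-- A structural causal model whose observable variables are `V`, with finite domains `Val`, and
whose mechanism for `i` reads the parents of `i` in `G` and the latent variables in `U i`. The
latent variables are finite in number, have finite domains and an arbitrary joint law. -/
structure SCM {V : Type} (G : CausalDiagram V) (Val : V → Type) where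
  Latent : Type
  [latentFintype : Fintype Latent]
  Dom : Latent → Type
  [domFintype : ∀ k, Fintype (Dom k)]
  prob : (∀ k, Dom k) → ℝ
  prob_nonneg : ∀ u, 0 ≤ prob u
  prob_sum : ∑ u, prob u = 1
  U : V → Set Latent
  f : ∀ i, ((k : Latent) → k ∈ U i → Dom k) → PaVal G Val i → Val i

attribute [instance] SCM.latentFintype SCM.domFintype

variable {V : Type} {G : CausalDiagram V} {Val : V → Type}

/-- Probability of an event about the latent variables. -/
def SCM.pr (M : SCM G Val) (E : (∀ k, M.Dom k) → Prop) : ℝ :=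
  ∑ u, if E u then M.prob u else 0

/-- `u` and `w` agree on all latent variables read by the mechanisms of `A`. -/
def SCM.Agree (M : SCM G Val) (A : Finset V) (u w : ∀ k, M.Dom k) : Prop :=
  ∀ i ∈ A, ∀ k ∈ M.U i, u k = w k

/-- The latent vectors `U_A` and `U_B` are independent. -/
def SCM.Indep (M : SCM G Val) (A B : Finset V) : Prop :=
  ∀ u v, M.pr (fun w => M.Agree A u w ∧ M.Agree B v w) =
    M.pr (M.Agree A u) * M.pr (M.Agree B v)

/-- `M` induces `G` (the directed part of the diagram is built into the type): the latent
vectors of `i` and `j` are dependent if `i`, `j` are joined by a bidirected edge, and the latent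
vectors of two disjoint sets of variables with no bidirected edge between them are independent. -/
def SCM.Induces (M : SCM G Val) : Prop :=
  (∀ i j, G.bidir.Adj i j → ¬ M.Indep {i} {j}) ∧
  ∀ A B : Finset V, Disjoint A B → (∀ i ∈ A, ∀ j ∈ B, ¬ G.bidir.Adj i j) → M.Indep A B

/-- The values of all observable variables at the unit `u` in the submodel `do(x)`, where
`x j = none` means that `j` is not intervened on. -/
def SCM.response [Fintype V] (M : SCM G Val) (x : ∀ j, Option (Val j)) (u : ∀ k, M.Dom k) :
    ∀ v, Val v :=
  G.wf.fix (C := Val) fun v rec =>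
    match x v with
    | some a => a
    | none => M.f v (fun k _ => u k) (fun j h => rec j h)

/-- An atomic event `V_{[pa]} = v`. -/
@[ext] structure Term (G : CausalDiagram V) (Val : V → Type) where
  var : V
  sub : PaVal G Val var
  val : Val var

/-- The intervention in the subscript of a term. -/
def Term.regime (a : Term G Val) : ∀ j, Option (Val j) :=
  fun j => if h : G.dir j a.var then some (a.sub j h) else none

/-- The potential response of a term, at the unit `u`. -/
def Term.responseAt [Fintype V] (a : Term G Val) (M : SCM G Val) (u : ∀ k, M.Dom k) :
    Val a.var :=
  M.response a.regime u a.var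

theorem Term.responseAt_eq [Fintype V] (a : Term G Val) (M : SCM G Val) (u : ∀ k, M.Dom k) :
    a.responseAt M u = M.f a.var (fun k _ => u k) a.sub := by
  have hself : ¬ G.dir a.var a.var := fun h => G.acyclic _ (Relation.TransGen.single h)
  unfold Term.responseAt SCM.response
  rw [WellFounded.fix_eq]
  have h0 : a.regime a.var = none := by simp [Term.regime, hself]
  rw [h0]
  simp only
  congr 1
  funext j h
  rw [WellFounded.fix_eq]
  have h1 : a.regime j = some (a.sub j h) := by simp [Term.regime, h]
  rw [h1]

/-- A counterfactual event `W_⋆ = w` is a finite set of terms. Its ctf-factor is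
`Q[W_⋆](w) = P(W_⋆ = w)`. -/
def SCM.ctfFactor [Fintype V] (M : SCM G Val) (W : Finset (Term G Val)) : ℝ :=
  M.pr fun u => ∀ a ∈ W, a.responseAt M u = a.val

/-- All distributions are positive: every ctf-factor is positive, unless its event gives two
values to the same potential response. -/
def SCM.Positive [Fintype V] (M : SCM G Val) : Prop :=
  ∀ W : Finset (Term G Val),
    (∀ i (pa : PaVal G Val i) (v v' : Val i), ⟨i, pa, v⟩ ∈ W → ⟨i, pa, v'⟩ ∈ W → v = v') →
    0 < M.ctfFactor W

/-! ### Ctf-factors as functions of their values, identifiability -/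

/-- The set `V(W_⋆)` of observable variables of an event. -/
def vars (W : Finset (Term G Val)) : Finset V := W.image Term.var

/-- Each observable variable appears at most once. -/
def AtMostOnce (W : Finset (Term G Val)) : Prop :=
  ∀ a ∈ W, ∀ b ∈ W, a.var = b.var → a = b

/-- The value of `a` occurs (as the value of the variable of `a`) in the subscript of `b`. -/
def Chained (a b : Term G Val) : Prop :=
  ∃ h : G.dir a.var b.var, b.sub a.var h = a.val

/-- The term `b` of `T_⋆ = t` after the values `t` have been replaced by `s`: the occurrences
of values from `t` in its subscript move along, all other subscripts stay fixed. -/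
def Term.move (T : Finset (Term G Val)) (s : ∀ v, Val v) (b : Term G Val) : Term G Val where
  var := b.var
  sub := fun j h => if ∃ a ∈ T, a.var = j ∧ Chained a b then s j else b.sub j h
  val := s b.var

/-- The ctf-factor `Q[T_⋆](t)` of the model `M` as a function of the values `t`. -/
def SCM.ctfFamily [Fintype V] (M : SCM G Val) (T : Finset (Term G Val)) :
    (∀ v, Val v) → ℝ :=
  fun s => M.ctfFactor (T.image (Term.move T s))

/-- `Q[C_⋆](c)` is identifiable from `Q[T_⋆](t)` and `G`: it is a function of the input
distribution on the class of positive models that induce `G`. -/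
def Identifiable [Fintype V] (T C : Finset (Term G Val)) : Prop :=
  ∀ M₁ M₂ : SCM G Val, M₁.Induces → M₂.Induces → M₁.Positive → M₂.Positive →
    M₁.ctfFamily T = M₂.ctfFamily T → M₁.ctfFactor C = M₂.ctfFactor C

/-! ### The algorithm -/

/-- Expressions in the input distribution. -/
inductive Expr (V : Type) where
  | input : Expr V
  | marg (S : Finset V) (e : Expr V) : Expr V
  | div (e₁ e₂ : Expr V) : Expr V
  | prod (S : Finset V) (e : V → Expr V) : Expr V

/-- The value of an expression for the input distribution `q`, as a function of the values of
the observable variables; `marg S e` sums `e` over the values of the variables in `S`. -/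
def Expr.eval [Fintype V] [∀ v, Fintype (Val v)] (q : (∀ v, Val v) → ℝ) :
    Expr V → (∀ v, Val v) → ℝ
  | .input, t => q t
  | .marg S e, t => ∑ s : ∀ v, Val v, if ∀ v, v ∉ S → s v = t v then e.eval q s else 0
  | .div e₁ e₂, t => e₁.eval q t / e₂.eval q t
  | .prod S e, t => ∏ j ∈ S, (e j).eval q t

/-- `H` has no term whose subscript holds the value of a term of `T` outside `H`. -/
def ChainClosed (T H : Finset (Term G Val)) : Prop :=
  ∀ b ∈ H, ∀ a ∈ T, a ∉ H → ¬ Chained a b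

/-- The smallest chain-closed set between `C` and `T`. -/
def hull (C T : Finset (Term G Val)) : Finset (Term G Val) :=
  T.filter fun b => ∀ H, C ⊆ H → H ⊆ T → ChainClosed T H → b ∈ H

/-- The terms of `H` whose variable is joined to a variable of `C` by bidirected edges in
`G[V(H)]`: if `C ⊆ H` forms a single c-component, this is the c-component of `H` that
contains `C`. -/
def component (C H : Finset (Term G Val)) : Finset (Term G Val) :=
  H.filter fun b => ∃ a ∈ C,
    Relation.ReflTransGen (fun v w => G.bidir.Adj v w ∧ v ∈ vars H ∧ w ∈ vars H) a.var b.var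

/-- `o` is a topological order of `G[W]`. -/
def IsTopoOrder (G : CausalDiagram V) (W : Finset V) (o : V → ℕ) : Prop :=
  Set.InjOn o W ∧ ∀ i ∈ W, ∀ j ∈ W, G.dir i j → o i < o j

/-- The expression for the c-component with variables `K` of a ctf-factor with variables `W`
and expression `e`: the product, over `j ∈ K`, of the sum of `e` over the variables after `j`
divided by its sum over `j` and the variables after `j`. -/
def factorExpr (o : V → ℕ) (W K : Finset V) (e : Expr V) : Expr V :=
  .prod K fun j =>
    .div (.marg (W.filter fun h => o j < o h) e) (.marg (W.filter fun h => o j ≤ o h) e)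

theorem hull_subset (C T : Finset (Term G Val)) : hull C T ⊆ T := Finset.filter_subset _ _

theorem component_subset (C H : Finset (Term G Val)) : component C H ⊆ H :=
  Finset.filter_subset _ _

/-- The algorithm identify⁺ for the target `C`, called with the event `T` and an expression `e`
for `Q[T_⋆](t)`; `none` stands for FAIL. The topological order that it uses on `G[W]` is
`ord W`. -/
def identifyPlus (ord : Finset V → V → ℕ) (C T : Finset (Term G Val)) (e : Expr V) :
    Option (Expr V) :=
  if hull C T = C then some (.marg (vars (T \ C)) e)
  else if hT : hull C T = T then none
  else
    identifyPlus ord C (component C (hull C T))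
      (factorExpr (ord (vars (hull C T))) (vars (hull C T)) (vars (component C (hull C T)))
        (.marg (vars (T \ hull C T)) e))
termination_by T.card
decreasing_by
  exact lt_of_le_of_lt (Finset.card_le_card (component_subset C (hull C T)))
    (Finset.card_lt_card (lt_of_le_of_ne (hull_subset C T) hT))

/-- A run of identify⁺ on the target `C` and the event `T` calls identify⁺ (possibly at the
outermost level) on the event `T'`. -/
inductive CallsOn (C : Finset (Term G Val)) :
    Finset (Term G Val) → Finset (Term G Val) → Prop where
  | refl (T) : CallsOn C T T
  | step (T T') : hull C T ≠ C → hull C T ≠ T → CallsOn C (component C (hull C T)) T' →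
      CallsOn C T T'

/-! ### Ctf-forests and ctf-hedges -/

/-- `T_⋆ = t` is a ctf-forest rooted in `C_⋆ = c`, with subgraph `G'[V(T_⋆)]`. -/
structure IsCtfForest (G' : CausalDiagram V) (T C : Finset (Term G Val)) : Prop where
  subgraph : G'.IsSubgraph G
  atMostOnce : AtMostOnce T
  tree : (G'.bidir.induce (vars T : Set V)).IsTree
  root_subset : C ⊆ T
  ancestors : ∀ v ∈ vars T, ∃ w ∈ vars C,
    Relation.ReflTransGen (fun i j => G'.dir i j ∧ i ∈ vars T ∧ j ∈ vars T) v w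
  one_child : ∀ v ∈ vars T, ∀ w ∈ vars T, ∀ w' ∈ vars T, G'.dir v w → G'.dir v w' → w = w'

/-- `T_⋆ = t` is a ctf-hedge rooted in `C_⋆ = c`, with subgraph `G'[V(T_⋆)]`. -/
structure IsCtfHedge (G' : CausalDiagram V) (T C : Finset (Term G Val)) : Prop
    extends IsCtfForest G' T C where
  ne_root : T ≠ C
  chain : ∀ a ∈ T, a ∉ C → ∀ b ∈ T, G'.dir a.var b.var → Chained a b

end CtfId

end CtfIdDefs

noncomputable section

open Classical

namespace CtfId

variable {V : Type} {G : CausalDiagram V} {Val : V → Type}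

/-! Once subscripts and values are indexed by variables, a ctf-factor is the probability that given
values solve a system of structural equations, one per variable (`qFactor`). The equation of `v` has
as inputs the values chained to `v`, and all its other inputs are constants.

Soundness rests on two facts about such systems. By acyclicity, summing over variables that no
remaining equation reads deletes their equations (`sum_qFactor`), which is the marginalization to
the hull. Independence of latent vectors makes the factor multiplicative over sets with no
bidirected edge between them, so the quotient product isolates a c-component (`eval_factorExpr`).

Failure means that some call has an event whose hull is everything but which is larger than the
target. Each of its terms outside the target is then chained to another term; picking one such child
per term and a bidirected spanning tree gives a ctf-hedge (`exists_isCtfHedge`). Conversely a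
ctf-hedge inside the input survives every hull and every component, so the target is never isolated
(`IsCtfHedge.identifyPlus_eq_none`).

For completeness, let `T'` be the event of the failing call. The latent variables are uniformly
random response functions together with a coin for each pair of variables, read by both ends when
the pair is a bidirected edge. The uniform density is perturbed by `ε * (χ - φ)`, where `χ` is a
product of mean-zero weights over the variables of `C` and `φ` one over those of `T'`. In `φ` the
weight of each variable outside `C` is cancelled by its inverse, which the mechanism of its chosen
child computes from the chained value. So `χ` and `φ` agree on the whole input distribution. On the
event of `C` alone `φ` averages to zero and `χ` does not, hence `ε` and `0` give different targets
(`not_identifiable`). Connectedness of `C` and `T'` keeps the required independences intact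
(`perturbedMean_and`). -/

/-! ### Events about latent vectors -/

/-- The indicator of a proposition. -/
def ind (P : Prop) : ℝ := if P then 1 else 0

theorem ind_true {P : Prop} (h : P) : ind P = 1 := if_pos h

theorem ind_false {P : Prop} (h : ¬ P) : ind P = 0 := if_neg h

theorem ind_nonneg (P : Prop) : 0 ≤ ind P := by
  unfold ind
  split_ifs <;> norm_num

theorem ind_and (P Q : Prop) : ind (P ∧ Q) = ind P * ind Q := by
  by_cases hP : P <;> by_cases hQ : Q <;> simp [ind, hP, hQ]

theorem ite_eq_mul_ind (P : Prop) [Decidable P] (x : ℝ) : (if P then x else 0) = x * ind P := by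
  by_cases hP : P <;> simp [ind, hP]

theorem SCM.pr_eq_sum_mul (M : SCM G Val) (E : (∀ k, M.Dom k) → Prop) :
    M.pr E = ∑ u, M.prob u * ind (E u) :=
  Finset.sum_congr rfl fun _ _ => ite_eq_mul_ind _ _

theorem SCM.pr_congr (M : SCM G Val) {E F : (∀ k, M.Dom k) → Prop} (h : ∀ u, E u ↔ F u) :
    M.pr E = M.pr F := by
  have : E = F := funext fun u => propext (h u)
  rw [this]

theorem SCM.Agree.symm {M : SCM G Val} {A : Finset V} {u w : ∀ k, M.Dom k}
    (h : M.Agree A u w) : M.Agree A w u := fun i hi k hk => (h i hi k hk).symm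

theorem SCM.Agree.trans {M : SCM G Val} {A : Finset V} {u v w : ∀ k, M.Dom k}
    (h : M.Agree A u v) (h' : M.Agree A v w) : M.Agree A u w :=
  fun i hi k hk => (h i hi k hk).trans (h' i hi k hk)

/-- `E` is an event about the latent vector `U_A`. -/
def SCM.DependsOn (M : SCM G Val) (A : Finset V) (E : (∀ k, M.Dom k) → Prop) : Prop :=
  ∀ u w, M.Agree A u w → E u → E w

/-- The indicator of an event about `U_A` is a combination of indicators of values of `U_A`. -/
theorem SCM.DependsOn.exists_indicator_eq {M : SCM G Val} {A : Finset V}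
    {E : (∀ k, M.Dom k) → Prop} (hE : M.DependsOn A E) :
    ∃ c : (∀ k, M.Dom k) → ℝ, ∀ w, ind (E w) = ∑ u, c u * ind (M.Agree A u w) := by
  -- Many `u` represent the same value of the latent vector of `A`; dividing by their number `N`
  -- corrects the overcount.
  set N : (∀ k, M.Dom k) → ℝ := fun w => ∑ u, ind (M.Agree A u w)
  have hNpos : ∀ w, N w ≠ 0 := by
    intro w
    refine ne_of_gt (lt_of_lt_of_le zero_lt_one ?_)
    have := Finset.single_le_sum (f := fun u => ind (M.Agree A u w))
      (fun u _ => ind_nonneg _) (Finset.mem_univ w)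
    rwa [ind_true (show M.Agree A w w from fun _ _ _ _ => rfl)] at this
  refine ⟨fun u => ind (E u) / N u, fun w => ?_⟩
  have key : ∀ u, ind (E u) / N u * ind (M.Agree A u w) =
      ind (E w) / N w * ind (M.Agree A u w) := by
    intro u
    by_cases h : M.Agree A u w
    · have h1 : E u ↔ E w := ⟨hE _ _ h, hE _ _ h.symm⟩
      have h2 : N u = N w := Finset.sum_congr rfl fun v _ => by
        rw [show M.Agree A v u ↔ M.Agree A v w from
          ⟨fun h' => h'.trans h, fun h' => h'.trans h.symm⟩]
      rw [h1, h2]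
    · simp [ind_false h]
  rw [Finset.sum_congr rfl fun u _ => key u, ← Finset.mul_sum]
  change _ = _ * N w
  rw [div_mul_cancel₀ _ (hNpos w)]

/-- Independence is given only for single values of the two latent vectors. Both indicators are
combinations of indicators of such values, and both sides are bilinear in the coefficients. -/
theorem SCM.Indep.pr_and {M : SCM G Val} {A B : Finset V} (h : M.Indep A B)
    {E F : (∀ k, M.Dom k) → Prop} (hE : M.DependsOn A E) (hF : M.DependsOn B F) :
    M.pr (fun u => E u ∧ F u) = M.pr E * M.pr F := by
  obtain ⟨c, hc⟩ := hE.exists_indicator_eq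
  obtain ⟨d, hd⟩ := hF.exists_indicator_eq
  have hone : ∀ (c : (∀ k, M.Dom k) → ℝ) (A : Finset V),
      ∑ w, M.prob w * ∑ u, c u * ind (M.Agree A u w) = ∑ u, c u * M.pr (M.Agree A u) := by
    intro c A
    simp only [SCM.pr_eq_sum_mul, Finset.mul_sum]
    rw [Finset.sum_comm]
    exact Finset.sum_congr rfl fun u _ => Finset.sum_congr rfl fun w _ => by ring
  have hE' : M.pr E = ∑ u, c u * M.pr (M.Agree A u) := by
    rw [SCM.pr_eq_sum_mul, ← hone]
    exact Finset.sum_congr rfl fun w _ => by rw [hc]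
  have hF' : M.pr F = ∑ u, d u * M.pr (M.Agree B u) := by
    rw [SCM.pr_eq_sum_mul, ← hone]
    exact Finset.sum_congr rfl fun w _ => by rw [hd]
  rw [hE', hF', Finset.sum_mul_sum, SCM.pr_eq_sum_mul]
  have hw : ∀ w, M.prob w * ind (E w ∧ F w) =
      ∑ u, ∑ v, c u * d v * (M.prob w * ind (M.Agree A u w ∧ M.Agree B v w)) := by
    intro w
    rw [ind_and, hc, hd, Finset.sum_mul_sum, Finset.mul_sum]
    refine Finset.sum_congr rfl fun u _ => ?_
    rw [Finset.mul_sum]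
    refine Finset.sum_congr rfl fun v _ => ?_
    rw [ind_and]
    ring
  rw [Finset.sum_congr rfl fun w _ => hw w, Finset.sum_comm]
  refine Finset.sum_congr rfl fun u _ => ?_
  rw [Finset.sum_comm]
  refine Finset.sum_congr rfl fun v _ => ?_
  rw [← Finset.mul_sum, ← SCM.pr_eq_sum_mul, h u v]
  ring

/-! ### Factors of a system of equations -/

/-- The probability that `s` solves the structural equations of the variables in `W`, where the
mechanism of `v` is fed with the parent values `π v s`. -/
def SCM.qFactor (M : SCM G Val) (π : ∀ v, (∀ w, Val w) → PaVal G Val v) (W : Finset V)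
    (s : ∀ w, Val w) : ℝ :=
  M.pr fun u => ∀ v ∈ W, M.f v (fun k _ => u k) (π v s) = s v

/-- `π v s` depends only on the values `s j` with `D j v`. -/
def IsLocal (D : V → V → Prop) (π : ∀ v, (∀ w, Val w) → PaVal G Val v) : Prop :=
  ∀ v s s', (∀ j, D j v → s j = s' j) → π v s = π v s'

theorem SCM.dependsOn_equations (M : SCM G Val) (π : ∀ v, (∀ w, Val w) → PaVal G Val v)
    (W : Finset V) (s : ∀ w, Val w) :
    M.DependsOn W fun u => ∀ v ∈ W, M.f v (fun k _ => u k) (π v s) = s v := by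
  intro u w huw h v hv
  rw [← h v hv]
  congr 1
  funext k hk
  exact (huw v hv k hk).symm

theorem SCM.Induces.qFactor_mul {M : SCM G Val} (hM : M.Induces)
    (π : ∀ v, (∀ w, Val w) → PaVal G Val v) {A B : Finset V} (hAB : Disjoint A B)
    (hadj : ∀ i ∈ A, ∀ j ∈ B, ¬ G.bidir.Adj i j) (s : ∀ w, Val w) :
    M.qFactor π (A ∪ B) s = M.qFactor π A s * M.qFactor π B s := by
  unfold SCM.qFactor
  rw [← (hM.2 A B hAB hadj).pr_and (M.dependsOn_equations π A s) (M.dependsOn_equations π B s)]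
  refine M.pr_congr fun u => ?_
  simp only [Finset.mem_union]
  exact ⟨fun h => ⟨fun v hv => h v (.inl hv), fun v hv => h v (.inr hv)⟩,
    fun h v hv => hv.elim (h.1 v) (h.2 v)⟩

theorem SCM.qFactor_empty (M : SCM G Val) (π : ∀ v, (∀ w, Val w) → PaVal G Val v)
    (s : ∀ w, Val w) : M.qFactor π ∅ s = 1 := by
  simp [SCM.qFactor, SCM.pr, M.prob_sum]

/-- The equations form an event with one term per variable, so no potential response gets two
values. -/
theorem SCM.Positive.qFactor_pos [Fintype V] {M : SCM G Val} (hM : M.Positive)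
    (π : ∀ v, (∀ w, Val w) → PaVal G Val v) (W : Finset V) (s : ∀ w, Val w) :
    0 < M.qFactor π W s := by
  have h := hM (W.image fun v => (⟨v, π v s, s v⟩ : Term G Val)) (by
    intro i pa v v' h h'
    simp only [Finset.mem_image, Term.mk.injEq] at h h'
    obtain ⟨w, -, rfl, -, h1⟩ := h
    obtain ⟨w', -, rfl, -, h2⟩ := h'
    exact (eq_of_heq h1).symm.trans (eq_of_heq h2))
  refine lt_of_lt_of_eq h ?_
  unfold SCM.ctfFactor SCM.qFactor
  refine M.pr_congr fun u => ?_
  simp only [Finset.forall_mem_image, Term.responseAt_eq]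

/-- Recursion along an acyclic diagram has exactly one solution. -/
theorem CausalDiagram.existsUnique_solution [Fintype V] (G : CausalDiagram V)
    {D : V → V → Prop} (hD : ∀ j v, D j v → G.dir j v) (t : ∀ v, Val v)
    (F : ∀ v, (∀ w, Val w) → Val v)
    (hF : ∀ v s s', (∀ j, D j v → s j = s' j) → F v s = F v s') :
    ∃! s : ∀ v, Val v, ∀ v, s v = F v s := by
  let s : ∀ v, Val v := G.wf.fix (C := Val) fun v rec =>
    -- The fallback `t j` has no influence, since `F v` depends only on coordinates related to `v`
    -- by `D`.
    F v fun j => if h : G.dir j v then rec j h else t j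
  have hs : ∀ v, s v = F v s := by
    intro v
    change G.wf.fix (C := Val) _ v = _
    rw [WellFounded.fix_eq]
    refine hF v _ _ fun j hj => ?_
    simp only [hD j v hj, dif_pos]
    rfl
  refine ⟨s, hs, fun s' hs' => ?_⟩
  funext v
  induction v using G.wf.induction with
  | _ v ih =>
    rw [hs' v, hs v]
    exact hF v _ _ fun j hj => ih j (hD j v hj)

/-- Summing a factor over variables that no remaining equation reads removes their equations. -/
theorem SCM.sum_qFactor [Fintype V] [∀ v, Fintype (Val v)] (M : SCM G Val)
    {D : V → V → Prop} (hD : ∀ j v, D j v → G.dir j v)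
    {π : ∀ v, (∀ w, Val w) → PaVal G Val v} (hπ : IsLocal D π)
    {W H : Finset V} (hHW : H ⊆ W) (hclosed : ∀ v ∈ H, ∀ j ∈ W, j ∉ H → ¬ D j v)
    (t : ∀ v, Val v) :
    (∑ s : ∀ v, Val v, if ∀ v, v ∉ W \ H → s v = t v then M.qFactor π W s else 0) =
      M.qFactor π H t := by
  -- For each fixed unit, exactly one completion of `t` on `W \ H` solves the equations there, so
  -- the sum over completions counts one or zero according to the equations of `H`.
  have hcount : ∀ u : ∀ k, M.Dom k,
      (∑ s : ∀ v, Val v, ind ((∀ v, v ∉ W \ H → s v = t v) ∧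
        (∀ v ∈ W, M.f v (fun k _ => u k) (π v s) = s v))) =
      ind (∀ v ∈ H, M.f v (fun k _ => u k) (π v t) = t v) := by
    intro u
    obtain ⟨s₀, hs₀, huniq⟩ := G.existsUnique_solution hD t
      (fun v s => if v ∈ W \ H then M.f v (fun k _ => u k) (π v s) else t v)
      (fun v s s' h => by rw [hπ v s s' h])
    -- Closedness of `H`: its equations do not notice which completion is taken.
    have hoff : ∀ s : ∀ v, Val v, (∀ v, v ∉ W \ H → s v = t v) → ∀ v ∈ H, π v s = π v t := by
      intro s hs v hv
      refine hπ v _ _ fun j hj => hs j fun hjW => ?_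
      rw [Finset.mem_sdiff] at hjW
      exact hclosed v hv j hjW.1 hjW.2 hj
    have hs₀off : ∀ v, v ∉ W \ H → s₀ v = t v := fun v hv => by
      have := hs₀ v
      rwa [if_neg hv] at this
    have hiff : ∀ s : ∀ v, Val v, ((∀ v, v ∉ W \ H → s v = t v) ∧
        (∀ v ∈ W, M.f v (fun k _ => u k) (π v s) = s v)) ↔
        (s = s₀ ∧ ∀ v ∈ H, M.f v (fun k _ => u k) (π v t) = t v) := by
      intro s
      constructor
      · rintro ⟨h1, h2⟩
        refine ⟨huniq s fun v => ?_, fun v hv => ?_⟩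
        · by_cases hv : v ∈ W \ H
          · rw [if_pos hv, h2 v (Finset.mem_sdiff.1 hv).1]
          · rw [if_neg hv, h1 v hv]
        · have := h2 v (hHW hv)
          rwa [hoff s h1 v hv, h1 v (by simp [hv])] at this
      · rintro ⟨rfl, h2⟩
        refine ⟨hs₀off, fun v hv => ?_⟩
        by_cases hvH : v ∈ H
        · rw [hoff s hs₀off v hvH, hs₀off v (by simp [hvH]), h2 v hvH]
        · have := hs₀ v
          rw [if_pos (Finset.mem_sdiff.2 ⟨hv, hvH⟩)] at this
          exact this.symm
    simp only [hiff, ind_and, ← Finset.sum_mul]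
    rw [Finset.sum_eq_single s₀ (fun s _ hs => ind_false hs) (by simp), ind_true rfl, one_mul]
  have hexp : ∀ s : ∀ v, Val v,
      (if ∀ v, v ∉ W \ H → s v = t v then M.qFactor π W s else 0) =
      ∑ u, M.prob u * ind ((∀ v, v ∉ W \ H → s v = t v) ∧
        (∀ v ∈ W, M.f v (fun k _ => u k) (π v s) = s v)) := by
    intro s
    rw [ite_eq_mul_ind, SCM.qFactor, SCM.pr_eq_sum_mul, Finset.sum_mul]
    refine Finset.sum_congr rfl fun u _ => ?_
    rw [ind_and]
    ring
  rw [Finset.sum_congr rfl fun s _ => hexp s, Finset.sum_comm, SCM.qFactor, SCM.pr_eq_sum_mul]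
  refine Finset.sum_congr rfl fun u _ => ?_
  rw [← Finset.mul_sum, hcount u]

/-- Telescoping along a linear order of `K`. -/
theorem prod_div_telescope {ι : Type} (o : ι → ℕ) (g : Finset ι → ℝ) (hg : ∀ X, g X ≠ 0)
    (hg0 : g ∅ = 1) (K : Finset ι) (ho : Set.InjOn o K) :
    ∏ j ∈ K, g (K.filter fun h => o h ≤ o j) / g (K.filter fun h => o h < o j) = g K := by
  induction K using Finset.induction_on_max_value o with
  | empty => simp [hg0]
  | insert a s ha hmax ih =>
    have hlt : ∀ x ∈ s, o x < o a := fun x hx => lt_of_le_of_ne (hmax x hx) fun h =>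
      ha (ho (by simp [hx]) (by simp) h ▸ hx)
    rw [Finset.prod_insert ha]
    have h1 : (insert a s).filter (fun h => o h ≤ o a) = insert a s := by
      refine Finset.filter_true_of_mem fun x hx => ?_
      rcases Finset.mem_insert.1 hx with rfl | hx
      exacts [le_rfl, hmax x hx]
    have h2 : (insert a s).filter (fun h => o h < o a) = s := by
      rw [Finset.filter_insert, if_neg (lt_irrefl _), Finset.filter_true_of_mem hlt]
    have h3 : ∀ j ∈ s, g ((insert a s).filter fun h => o h ≤ o j) /
        g ((insert a s).filter fun h => o h < o j) =
        g (s.filter fun h => o h ≤ o j) / g (s.filter fun h => o h < o j) := by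
      intro j hj
      rw [Finset.filter_insert, if_neg (not_le.2 (hlt j hj)), Finset.filter_insert,
        if_neg (not_lt.2 (hmax j hj))]
    rw [h1, h2, Finset.prod_congr rfl h3, ih (ho.mono (by simp)), div_mul_cancel₀ _ (hg s)]

/-- The quotient formula for the factor of a union of c-components. -/
theorem SCM.eval_factorExpr [Fintype V] [∀ v, Fintype (Val v)] {M : SCM G Val}
    (hM : M.Induces) (hpos : M.Positive)
    {D : V → V → Prop} (hD : ∀ j v, D j v → G.dir j v)
    {π : ∀ v, (∀ w, Val w) → PaVal G Val v} (hπ : IsLocal D π)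
    {W K : Finset V} (hKW : K ⊆ W) (hadj : ∀ i ∈ K, ∀ j ∈ W, j ∉ K → ¬ G.bidir.Adj i j)
    {o : V → ℕ} (ho : IsTopoOrder G W o) {q : (∀ v, Val v) → ℝ} {e : Expr V}
    (he : ∀ s, e.eval q s = M.qFactor π W s) (t : ∀ v, Val v) :
    (factorExpr o W K e).eval q t = M.qFactor π K t := by
  have hmarg : ∀ p : V → Prop, (∀ i j, p i → o j < o i → p j) →
      (Expr.marg (W.filter fun h => ¬ p h) e).eval q t =
        M.qFactor π (W.filter fun h => p h) t := by
    intro p hp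
    rw [← M.sum_qFactor hD hπ (Finset.filter_subset p W) _ t]
    · simp only [Expr.eval, he, Finset.filter_not]
    · intro v hv j hj hj' hjv
      rw [Finset.mem_filter] at hv hj'
      exact hj' ⟨hj, hp v j hv.2 (ho.2 j hj v hv.1 (hD j v hjv))⟩
  have hsplit : ∀ p : V → Prop, M.qFactor π (W.filter fun h => p h) t =
      M.qFactor π (K.filter fun h => p h) t * M.qFactor π ((W \ K).filter fun h => p h) t := by
    intro p
    rw [← hM.qFactor_mul π (Finset.disjoint_filter_filter Finset.disjoint_sdiff)
      (fun i hi j hj => hadj i (Finset.mem_filter.1 hi).1 j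
        (Finset.mem_sdiff.1 (Finset.mem_filter.1 hj).1).1
        (Finset.mem_sdiff.1 (Finset.mem_filter.1 hj).1).2),
      ← Finset.filter_union, Finset.union_sdiff_of_subset hKW]
  rw [← prod_div_telescope o (fun X => M.qFactor π X t) (fun X => (hpos.qFactor_pos π X t).ne')
    (M.qFactor_empty π t) K (ho.1.mono (by simpa using hKW))]
  simp only [factorExpr, Expr.eval]
  refine Finset.prod_congr rfl fun j hj => ?_
  have h1 := hmarg (fun h => o h ≤ o j) fun i k hi hk => hk.le.trans hi
  have h2 := hmarg (fun h => o h < o j) fun i k hi hk => hk.trans hi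
  simp only [not_le, not_lt, Expr.eval] at h1 h2
  rw [h1, h2, hsplit, hsplit fun h => o h < o j]
  -- Since `j ∈ K` and `o` is injective on `W`, no variable of `W \ K` ties with `j`. The
  -- contribution of `W \ K` is thus the same in numerator and denominator and cancels.
  have h3 : ((W \ K).filter fun h => o h ≤ o j) = (W \ K).filter fun h => o h < o j := by
    refine Finset.filter_congr fun x hx => ⟨fun h => lt_of_le_of_ne h fun hxj => ?_, le_of_lt⟩
    rw [Finset.mem_sdiff] at hx
    exact hx.2 (ho.1 hx.1 (hKW hj) hxj ▸ hj)
  have h4 : ∀ {a b c d : ℝ}, c = d → d ≠ 0 → a * c / (b * d) = a / b := by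
    rintro a b c d rfl hc
    exact mul_div_mul_right _ _ hc
  refine (h4 ?_ (hpos.qFactor_pos π _ t).ne').trans ?_
  · congr 1
    convert h3
  · congr

/-! ### Events in coordinates -/

/-- Subscripts and values, indexed by the variables, of an event in which each variable appears
at most once. -/
structure Coords (T : Finset (Term G Val)) where
  sub : ∀ v, PaVal G Val v
  val : ∀ v, Val v
  eq : ∀ b ∈ T, b = ⟨b.var, sub b.var, val b.var⟩

theorem AtMostOnce.nonempty_coords [∀ v, Nonempty (Val v)] {T : Finset (Term G Val)}
    (hT : AtMostOnce T) : Nonempty (Coords T) := by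
  have h : ∀ v : V, ∃ p : PaVal G Val v × Val v, ∀ b ∈ T, b.var = v → b = ⟨v, p.1, p.2⟩ := by
    intro v
    by_cases hv : ∃ b ∈ T, b.var = v
    · obtain ⟨b, hb, rfl⟩ := hv
      exact ⟨(b.sub, b.val), fun b' hb' h => hT b' hb' b hb h⟩
    · exact ⟨(fun j _ => Classical.arbitrary _, Classical.arbitrary _),
        fun b hb h => absurd ⟨b, hb, h⟩ hv⟩
  choose p hp using h
  exact ⟨⟨fun v => (p v).1, fun v => (p v).2, fun b hb => hp b.var b hb rfl⟩⟩

theorem mem_vars {T : Finset (Term G Val)} {v : V} : v ∈ vars T ↔ ∃ a ∈ T, a.var = v := by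
  simp [vars]

theorem var_mem_vars {T : Finset (Term G Val)} {a : Term G Val} (h : a ∈ T) : a.var ∈ vars T :=
  mem_vars.2 ⟨a, h, rfl⟩

theorem vars_mono {S T : Finset (Term G Val)} (h : S ⊆ T) : vars S ⊆ vars T :=
  Finset.image_subset_image h

theorem AtMostOnce.mono {S T : Finset (Term G Val)} (hT : AtMostOnce T) (h : S ⊆ T) :
    AtMostOnce S := fun a ha b hb => hT a (h ha) b (h hb)

theorem AtMostOnce.var_mem_vars_iff {S T : Finset (Term G Val)} (hT : AtMostOnce T) (h : S ⊆ T)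
    {a : Term G Val} (ha : a ∈ T) : a.var ∈ vars S ↔ a ∈ S := by
  refine ⟨fun hv => ?_, var_mem_vars⟩
  obtain ⟨b, hb, hba⟩ := mem_vars.1 hv
  rwa [← hT b (h hb) a ha hba]

theorem AtMostOnce.vars_sdiff {S T : Finset (Term G Val)} (hT : AtMostOnce T) (h : S ⊆ T) :
    vars (T \ S) = vars T \ vars S := by
  ext v
  simp only [mem_vars, Finset.mem_sdiff]
  constructor
  · rintro ⟨a, ⟨ha, haS⟩, rfl⟩
    refine ⟨⟨a, ha, rfl⟩, ?_⟩
    rintro ⟨b, hb, hba⟩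
    exact haS (hT b (h hb) a ha hba ▸ hb)
  · rintro ⟨⟨a, ha, rfl⟩, hv⟩
    exact ⟨a, ⟨ha, fun haS => hv ⟨a, haS, rfl⟩⟩, rfl⟩

namespace Coords

variable {T : Finset (Term G Val)} (κ : Coords T)

/-- The subscript of `v` holds the value of `j` in the event. -/
def Reads (j v : V) : Prop := ∃ h : G.dir j v, j ∈ vars T ∧ κ.sub v j h = κ.val j

theorem Reads.dir {κ : Coords T} {j v : V} (h : κ.Reads j v) : G.dir j v := h.1

/-- The subscript of `v` after the values of the event have been replaced by `s`. -/
def pa (v : V) (s : ∀ w, Val w) : PaVal G Val v :=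
  fun j h => if j ∈ vars T ∧ κ.sub v j h = κ.val j then s j else κ.sub v j h

theorem isLocal_pa : IsLocal κ.Reads κ.pa := by
  intro v s s' h
  funext j hj
  unfold pa
  split_ifs with hc
  · exact h j ⟨hj, hc⟩
  · rfl

theorem pa_val (v : V) : κ.pa v κ.val = κ.sub v := by
  funext j hj
  unfold pa
  split_ifs with hc
  · exact hc.2.symm
  · rfl

theorem pa_of_reads {j v : V} (h : κ.Reads j v) (s : ∀ w, Val w) :
    κ.pa v s j h.1 = s j := if_pos h.2

theorem sub_eq {b : Term G Val} (hb : b ∈ T) : b.sub = κ.sub b.var := by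
  obtain ⟨v, p, x⟩ := b
  have := κ.eq _ hb
  simp only [Term.mk.injEq, heq_eq_eq, true_and] at this
  exact this.1

theorem val_eq {b : Term G Val} (hb : b ∈ T) : b.val = κ.val b.var := by
  obtain ⟨v, p, x⟩ := b
  have := κ.eq _ hb
  simp only [Term.mk.injEq, heq_eq_eq, true_and] at this
  exact this.2

theorem chained_iff {a b : Term G Val} (ha : a ∈ T) (hb : b ∈ T) :
    Chained a b ↔ κ.Reads a.var b.var := by
  unfold Chained Reads
  rw [κ.sub_eq hb, κ.val_eq ha]
  simp only [var_mem_vars ha, true_and]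

theorem move_sub {b : Term G Val} (hb : b ∈ T) (s : ∀ w, Val w) :
    (b.move T s).sub = κ.pa b.var s := by
  funext j h
  change (if ∃ a ∈ T, a.var = j ∧ Chained a b then s j else b.sub j h) = _
  unfold pa
  rw [κ.sub_eq hb]
  refine if_congr ?_ rfl rfl
  constructor
  · rintro ⟨a, ha, rfl, hab⟩
    exact ((κ.chained_iff ha hb).1 hab).2
  · rintro ⟨hj, hval⟩
    obtain ⟨a, ha, rfl⟩ := mem_vars.1 hj
    exact ⟨a, ha, rfl, (κ.chained_iff ha hb).2 ⟨h, hj, hval⟩⟩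

/-- The bridge from the input distribution to systems of equations: moving the chained subscripts
along with `s` is the same as feeding the mechanisms with `κ.pa`. -/
theorem ctfFamily_eq [Fintype V] (M : SCM G Val) (s : ∀ w, Val w) :
    M.ctfFamily T s = M.qFactor κ.pa (vars T) s := by
  unfold SCM.ctfFamily SCM.ctfFactor SCM.qFactor vars
  refine M.pr_congr fun u => ?_
  simp only [Finset.forall_mem_image, Term.responseAt_eq]
  refine forall₂_congr fun b hb => ?_
  rw [κ.move_sub hb]
  rfl

theorem ctfFactor_eq [Fintype V] (M : SCM G Val) {C : Finset (Term G Val)} (hC : C ⊆ T) :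
    M.ctfFactor C = M.qFactor κ.pa (vars C) κ.val := by
  unfold SCM.ctfFactor SCM.qFactor vars
  refine M.pr_congr fun u => ?_
  simp only [Finset.forall_mem_image, Term.responseAt_eq]
  refine forall₂_congr fun b hb => ?_
  rw [κ.pa_val, κ.sub_eq (hC hb), κ.val_eq (hC hb)]

end Coords

/-! ### Hulls and components -/

theorem subset_hull {C T : Finset (Term G Val)} (h : C ⊆ T) : C ⊆ hull C T :=
  fun _ hb => Finset.mem_filter.2 ⟨h hb, fun _ hC _ _ => hC hb⟩

/-- The hull is an intersection of chain-closed sets, and chain-closedness passes to intersections.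
-/
theorem chainClosed_hull (C T : Finset (Term G Val)) : ChainClosed T (hull C T) := by
  intro b hb a ha haH hab
  refine haH (Finset.mem_filter.2 ⟨ha, fun H hC hHT hH => ?_⟩)
  by_contra haH'
  exact hH b ((Finset.mem_filter.1 hb).2 H hC hHT hH) a ha haH' hab

/-- If the hull is everything, each term outside the target is chained to another term. -/
theorem exists_chained_of_hull_eq {C T : Finset (Term G Val)} (hCT : C ⊆ T)
    (h : hull C T = T) {a : Term G Val} (ha : a ∈ T) (haC : a ∉ C) : ∃ b ∈ T, Chained a b := by
  by_contra! hno
  have hmem : a ∈ hull C T := h.symm ▸ ha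
  -- If `a` is chained to nothing in `T`, then `T` without `a` is still chain-closed and contains
  -- `C`, so the hull would omit `a`.
  have := (Finset.mem_filter.1 hmem).2 (T.erase a)
    (fun c hc => Finset.mem_erase.2 ⟨fun hca => haC (hca ▸ hc), hCT hc⟩) (Finset.erase_subset _ _)
    (fun b hb a' ha' ha'' => by
      have : a' = a := by
        by_contra hne
        exact ha'' (Finset.mem_erase.2 ⟨hne, ha'⟩)
      rw [this]
      exact hno b (Finset.mem_of_mem_erase hb))
  exact (Finset.mem_erase.1 this).1 rfl

theorem subset_component {C H : Finset (Term G Val)} (h : C ⊆ H) : C ⊆ component C H :=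
  fun c hc => Finset.mem_filter.2 ⟨h hc, c, hc, .refl⟩

theorem not_adj_component {C H : Finset (Term G Val)} :
    ∀ i ∈ vars (component C H), ∀ j ∈ vars H, j ∉ vars (component C H) → ¬ G.bidir.Adj i j := by
  intro i hi j hj hjK hij
  obtain ⟨a, ha, rfl⟩ := mem_vars.1 hi
  obtain ⟨b, hb, rfl⟩ := mem_vars.1 hj
  obtain ⟨haH, c, hc, hca⟩ := Finset.mem_filter.1 ha
  exact hjK (var_mem_vars (Finset.mem_filter.2
    ⟨hb, c, hc, hca.tail ⟨hij, var_mem_vars haH, var_mem_vars hb⟩⟩))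

theorem CausalDiagram.isCComponent_iff {W : Finset V} : G.IsCComponent W ↔
    W.Nonempty ∧ ∀ v ∈ W, ∀ w ∈ W,
      Relation.ReflTransGen (fun v w => G.bidir.Adj v w ∧ v ∈ W ∧ w ∈ W) v w := by
  unfold CausalDiagram.IsCComponent
  rw [SimpleGraph.connected_iff]
  constructor
  · rintro ⟨hpre, ⟨v, hv⟩⟩
    refine ⟨⟨v, hv⟩, fun v hv w hw => ?_⟩
    have := (SimpleGraph.reachable_iff_reflTransGen _ _).1 (hpre ⟨v, hv⟩ ⟨w, hw⟩)
    exact this.lift Subtype.val fun a b hab => ⟨hab, a.2, b.2⟩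
  · rintro ⟨⟨v, hv⟩, h⟩
    refine ⟨fun a b => ?_, ⟨⟨v, hv⟩⟩⟩
    have key : ∀ w, Relation.ReflTransGen (fun v w => G.bidir.Adj v w ∧ v ∈ W ∧ w ∈ W) a.1 w →
        ∀ hw : w ∈ (W : Set V), (G.bidir.induce (W : Set V)).Reachable a ⟨w, hw⟩ := by
      intro w hw
      induction hw with
      | refl => exact fun _ => SimpleGraph.Reachable.refl _
      | tail _ hbc ih =>
        exact fun hw => (ih hbc.2.1).trans (SimpleGraph.Adj.reachable hbc.1)
    exact key b.1 (h a.1 a.2 b.1 b.2) b.2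

theorem isCComponent_component {C H : Finset (Term G Val)}
    (hC : G.IsCComponent (vars C)) (hCH : C ⊆ H) : G.IsCComponent (vars (component C H)) := by
  rw [CausalDiagram.isCComponent_iff] at hC ⊢
  have hsub := vars_mono (subset_component hCH)
  have hsymm : Std.Symm fun v w => G.bidir.Adj v w ∧ v ∈ vars (component C H) ∧
    w ∈ vars (component C H) := ⟨fun v w h => ⟨h.1.symm, h.2.2, h.2.1⟩⟩
  have key : ∀ b ∈ component C H, ∃ c ∈ C, Relation.ReflTransGen (fun v w => G.bidir.Adj v w ∧
      v ∈ vars (component C H) ∧ w ∈ vars (component C H)) c.var b.var := by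
    intro b hb
    obtain ⟨hbH, c, hc, hcb⟩ := Finset.mem_filter.1 hb
    refine ⟨c, hc, ?_⟩
    -- A bidirected path in `H` that starts in `C` never leaves the component, because no edge of
    -- `H` does.
    have hlift : ∀ w, Relation.ReflTransGen (fun v w => G.bidir.Adj v w ∧ v ∈ vars H ∧
        w ∈ vars H) c.var w → w ∈ vars (component C H) ∧ Relation.ReflTransGen
        (fun v w => G.bidir.Adj v w ∧ v ∈ vars (component C H) ∧
          w ∈ vars (component C H)) c.var w := by
      intro w hw
      induction hw with
      | refl => exact ⟨hsub (var_mem_vars hc), .refl⟩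
      | tail _ hbc ih =>
        have hmem := ih.1
        by_contra hcon
        refine not_adj_component _ ih.1 _ hbc.2.2 (fun hm => ?_) hbc.1
        exact hcon ⟨hm, ih.2.tail ⟨hbc.1, hmem, hm⟩⟩
    exact (hlift b.var hcb).2
  refine ⟨hC.1.mono hsub, fun v hv w hw => ?_⟩
  obtain ⟨a, ha, rfl⟩ := mem_vars.1 hv
  obtain ⟨b, hb, rfl⟩ := mem_vars.1 hw
  obtain ⟨c, hc, hca⟩ := key a ha
  obtain ⟨d, hd, hdb⟩ := key b hb
  refine (symm hca).trans (.trans ?_ hdb)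
  exact (hC.2 _ (var_mem_vars hc) _ (var_mem_vars hd)).lift id
    fun x y h => ⟨h.1, hsub h.2.1, hsub h.2.2⟩

/-! ### Soundness -/

/-- The invariant of the recursion is `he`. The coordinates `κ` stay those of the outermost event
`T₀`, so a subscript value chained from a term dropped by an earlier call still varies;
chain-closedness and the quotient formula remain valid for this larger dependence. -/
theorem identifyPlus_sound [Fintype V] [∀ v, Fintype (Val v)] {M : SCM G Val}
    (hM : M.Induces) (hpos : M.Positive) {T₀ C : Finset (Term G Val)} (hT₀ : AtMostOnce T₀)
    (κ : Coords T₀) {ord : Finset V → V → ℕ} (h_ord : ∀ W, IsTopoOrder G W (ord W))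
    {q : (∀ v, Val v) → ℝ} (T : Finset (Term G Val)) (e e' : Expr V) (hCT : C ⊆ T) (hTT₀ : T ⊆ T₀)
    (he : ∀ s, e.eval q s = M.qFactor κ.pa (vars T) s)
    (hrun : identifyPlus ord C T e = some e') (t : ∀ v, Val v) :
    e'.eval q t = M.qFactor κ.pa (vars C) t := by
  have hmarg : ∀ (T H : Finset (Term G Val)) (e : Expr V), H ⊆ T → T ⊆ T₀ → ChainClosed T H →
      (∀ s, e.eval q s = M.qFactor κ.pa (vars T) s) →
      ∀ t, (Expr.marg (vars (T \ H)) e).eval q t = M.qFactor κ.pa (vars H) t := by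
    intro T H e hHT hT hcl he t
    rw [← M.sum_qFactor (fun j v h => h.dir) κ.isLocal_pa (vars_mono hHT) _ t]
    · simp only [Expr.eval, he, (hT₀.mono hT).vars_sdiff hHT]
    · intro v hv j hj hjH hread
      obtain ⟨b, hb, rfl⟩ := mem_vars.1 hv
      obtain ⟨a, ha, rfl⟩ := mem_vars.1 hj
      exact hcl b hb a ha (fun h => hjH (var_mem_vars h))
        ((κ.chained_iff (hT ha) (hT (hHT hb))).2 hread)
  induction T, e using identifyPlus.induct ord C with
  | case1 T e h =>
    rw [identifyPlus, if_pos h, Option.some.injEq] at hrun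
    rw [← hrun]
    exact hmarg T C e hCT hTT₀ (h ▸ chainClosed_hull C T) he t
  | case2 T e h h' =>
    rw [identifyPlus, if_neg h, dif_pos h'] at hrun
    cases hrun
  | case3 T e h h' ih =>
    rw [identifyPlus, if_neg h, dif_neg h'] at hrun
    have hH := hull_subset C T
    refine ih (subset_component (subset_hull hCT))
      ((component_subset _ _).trans (hH.trans hTT₀)) (fun s => ?_) hrun
    exact SCM.eval_factorExpr hM hpos (fun j v h => h.dir) κ.isLocal_pa
      (vars_mono (component_subset _ _))
      not_adj_component (h_ord _)
      (hmarg T _ e hH hTT₀ (chainClosed_hull C T) he) s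

/-! ### Failure and ctf-hedges -/

theorem CallsOn.invariant {C T T' : Finset (Term G Val)} (h : CallsOn C T T') (hCT : C ⊆ T)
    (hC : G.IsCComponent (vars C)) (hTc : G.IsCComponent (vars T)) :
    C ⊆ T' ∧ T' ⊆ T ∧ G.IsCComponent (vars T') := by
  induction h with
  | refl T => exact ⟨hCT, subset_rfl, hTc⟩
  | step T T' _ _ _ ih =>
    have hsub := (component_subset C (hull C T)).trans (hull_subset C T)
    obtain ⟨h1, h2, h3⟩ := ih (subset_component (subset_hull hCT))
      (isCComponent_component hC (subset_hull hCT))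
    exact ⟨h1, h2.trans hsub, h3⟩

theorem exists_call_of_identifyPlus_eq_none {ord : Finset V → V → ℕ} {C : Finset (Term G Val)}
    (T : Finset (Term G Val)) (e : Expr V) (h : identifyPlus ord C T e = none) :
    ∃ T', CallsOn C T T' ∧ hull C T' ≠ C ∧ hull C T' = T' := by
  induction T, e using identifyPlus.induct ord C with
  | case1 T e h1 =>
    rw [identifyPlus, if_pos h1] at h
    cases h
  | case2 T e h1 h2 => exact ⟨T, .refl T, h1, h2⟩
  | case3 T e h1 h2 ih =>
    rw [identifyPlus, if_neg h1, dif_neg h2] at h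
    obtain ⟨T', hcall, h3⟩ := ih h
    exact ⟨T', .step T T' h1 h2 hcall, h3⟩

theorem IsCtfHedge.root_nonempty {G' : CausalDiagram V} {T C : Finset (Term G Val)}
    (h : IsCtfHedge G' T C) : C.Nonempty := by
  obtain ⟨⟨v, hv⟩⟩ := h.tree.connected.nonempty
  obtain ⟨w, hw, -⟩ := h.ancestors v hv
  obtain ⟨c, hc, -⟩ := mem_vars.1 hw
  exact ⟨c, hc⟩

/-- A chain-closed set containing the root absorbs the hedge backwards along the directed paths to
the root, since each term outside `C` is chained to the term of its child. -/
theorem IsCtfHedge.subset_hull {G' : CausalDiagram V} {T' T C : Finset (Term G Val)}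
    (h : IsCtfHedge G' T' C) (hT : T' ⊆ T) : T' ⊆ hull C T := by
  intro a ha
  refine Finset.mem_filter.2 ⟨hT ha, fun H hCH _ hH => ?_⟩
  obtain ⟨w, hw, hpath⟩ := h.ancestors a.var (var_mem_vars ha)
  have key : ∀ v, Relation.ReflTransGen
      (fun i j => G'.dir i j ∧ i ∈ vars T' ∧ j ∈ vars T') v w →
      ∀ a ∈ T', a.var = v → a ∈ H := by
    intro v hv
    induction hv using Relation.ReflTransGen.head_induction_on with
    | refl =>
      intro a ha hav
      subst hav
      exact hCH ((h.atMostOnce.var_mem_vars_iff h.root_subset ha).1 hw)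
    | head hvc _ ih =>
      intro a ha hav
      subst hav
      by_cases haC : a ∈ C
      · exact hCH haC
      · obtain ⟨b, hb, rfl⟩ := mem_vars.1 hvc.2.2
        by_contra haH
        exact hH b (ih b hb rfl) a (hT ha) haH (h.chain a ha haC b hb hvc.1)
  exact key a.var hpath a ha rfl

/-- The bidirected spanning tree of the hedge joins each of its variables to the root. -/
theorem IsCtfHedge.subset_component {G' : CausalDiagram V} {T' H C : Finset (Term G Val)}
    (h : IsCtfHedge G' T' C) (hH : T' ⊆ H) : T' ⊆ component C H := by
  intro a ha
  obtain ⟨c, hc⟩ := h.root_nonempty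
  refine Finset.mem_filter.2 ⟨hH ha, c, hc, ?_⟩
  have hconn : G'.IsCComponent (vars T') := h.tree.connected
  refine ((CausalDiagram.isCComponent_iff.1 hconn).2 _ (var_mem_vars (h.root_subset hc)) _
    (var_mem_vars ha)).lift id fun x y hxy => ?_
  exact ⟨h.subgraph.2 hxy.1, vars_mono hH hxy.2.1, vars_mono hH hxy.2.2⟩

theorem IsCtfHedge.identifyPlus_eq_none {G' : CausalDiagram V} {T' C : Finset (Term G Val)}
    (h : IsCtfHedge G' T' C) (ord : Finset V → V → ℕ) (T : Finset (Term G Val)) (e : Expr V)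
    (hT : T' ⊆ T) : identifyPlus ord C T e = none := by
  -- The hull contains the hedge, which is strictly larger than `C`; so the successful branch is
  -- never taken.
  have hne : ∀ T, T' ⊆ T → hull C T ≠ C := fun T hT heq =>
    h.ne_root ((h.subset_hull hT).trans heq.subset |>.antisymm h.root_subset)
  induction T, e using identifyPlus.induct ord C with
  | case1 T e h1 => exact absurd h1 (hne T hT)
  | case2 T e h1 h2 => rw [identifyPlus, if_neg h1, dif_pos h2]
  | case3 T e h1 h2 ih =>
    rw [identifyPlus, if_neg h1, dif_neg h2]
    exact ih (h.subset_component (h.subset_hull hT))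

theorem CausalDiagram.wf_swap [Fintype V] (G : CausalDiagram V) :
    WellFounded (Function.swap G.dir) :=
  CausalDiagram.wf ⟨Function.swap G.dir, G.bidir, fun v h =>
    G.acyclic v (Relation.transGen_swap.1 h)⟩

/-- A connected event whose terms outside the target are all chained to other terms is a
ctf-hedge. -/
theorem exists_isCtfHedge [Fintype V] {T C : Finset (Term G Val)} (hT : AtMostOnce T)
    (hCT : C ⊆ T) (hconn : G.IsCComponent (vars T)) (hne : T ≠ C)
    (hch : ∀ a ∈ T, a ∉ C → ∃ b ∈ T, Chained a b) : ∃ G', IsCtfHedge G' T C := by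
  obtain ⟨F, hF, htree⟩ := SimpleGraph.Connected.exists_isTree_le hconn
  have hch' : ∀ a : Term G Val, ∃ b, a ∈ T → a ∉ C → b ∈ T ∧ Chained a b := by
    intro a
    by_cases ha : a ∈ T ∧ a ∉ C
    · obtain ⟨b, hb⟩ := hch a ha.1 ha.2
      exact ⟨b, fun _ _ => hb⟩
    · exact ⟨a, fun h h' => absurd ⟨h, h'⟩ ha⟩
  choose ch hch' using hch'
  have hdir : ∀ i j, (∃ a ∈ T, a ∉ C ∧ a.var = i ∧ (ch a).var = j) → G.dir i j := by
    rintro i j ⟨a, ha, haC, rfl, rfl⟩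
    exact (hch' a ha haC).2.1
  -- The only directed edges kept run from a term outside `C` to its chosen child; roots get no
  -- child. The bidirected edges are those of the spanning tree.
  let G' : CausalDiagram V :=
    { dir := fun i j => ∃ a ∈ T, a ∉ C ∧ a.var = i ∧ (ch a).var = j
      bidir := F.map (Function.Embedding.subtype _)
      acyclic := fun v h => G.acyclic v (h.lift id hdir) }
  refine ⟨G', ⟨⟨⟨hdir, ?_⟩, hT, ?_, hCT, ?_, ?_⟩, hne, ?_⟩⟩
  · rintro x y ⟨-, x', y', hxy, rfl, rfl⟩
    exact hF hxy
  · have : G'.bidir.induce (vars T : Set V) = F := SimpleGraph.comap_map_eq _ _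
    rw [this]
    exact htree
  · intro v
    induction v using G.wf_swap.induction with
    | _ v ih =>
      intro hv
      obtain ⟨a, ha, rfl⟩ := mem_vars.1 hv
      by_cases haC : a ∈ C
      · exact ⟨a.var, var_mem_vars haC, .refl⟩
      · obtain ⟨hb, hab⟩ := hch' a ha haC
        obtain ⟨w, hw, hpath⟩ := ih (ch a).var hab.1 (var_mem_vars hb)
        exact ⟨w, hw, hpath.head ⟨⟨a, ha, haC, rfl, rfl⟩, hv, var_mem_vars hb⟩⟩
  · rintro v - w - w' - ⟨a, ha, -, rfl, rfl⟩ ⟨a', ha', -, h, rfl⟩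
    rw [hT a' ha' a ha h]
  · rintro a ha haC b hb ⟨a', ha', -, h, h'⟩
    obtain rfl := hT a' ha' a ha h
    obtain ⟨h1, h2⟩ := hch' a' ha haC
    rwa [← hT _ h1 b hb h']

/-! ### Product weights on finite products -/

theorem ind_forall {ι : Type} [Fintype ι] (E : ι → Prop) : ind (∀ k, E k) = ∏ k, ind (E k) := by
  by_cases h : ∀ k, E k
  · rw [ind_true h, Finset.prod_eq_one fun k _ => ind_true (h k)]
  · obtain ⟨k, hk⟩ := not_forall.1 h
    rw [ind_false h, Finset.prod_eq_zero (Finset.mem_univ k) (ind_false hk)]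

section Box

variable {ι : Type} [Fintype ι] {D : ι → Type} [∀ k, Fintype (D k)]

/-- The mean, under the uniform law on `∀ k, D k`, of the product of the weights `p k` on the
event that all `E k` hold. -/
def boxMean (p : ∀ k, D k → ℝ) (E : ∀ k, D k → Prop) : ℝ :=
  ∏ k, (∑ x, p k x * ind (E k x)) / Fintype.card (D k)

theorem sum_box (p : ∀ k, D k → ℝ) (E : ∀ k, D k → Prop) :
    ∑ u : ∀ k, D k, (∏ k, p k (u k)) / (∏ k, (Fintype.card (D k) : ℝ)) *
      ind (∀ k, E k (u k)) = boxMean p E := by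
  unfold boxMean
  rw [Finset.prod_div_distrib, Finset.prod_univ_sum, Fintype.piFinset_univ, Finset.sum_div]
  refine Finset.sum_congr rfl fun u _ => ?_
  rw [ind_forall, Finset.prod_mul_distrib]
  ring

/-- `p` has mean zero in the coordinates in `S` and is trivial in the others. -/
structure IsContrast (S : Set ι) (p : ∀ k, D k → ℝ) : Prop where
  sum_eq_zero : ∀ k ∈ S, ∑ x, p k x = 0
  eq_one : ∀ k, k ∉ S → ∀ x, p k x = 1

/-- An event that leaves a mean-zero coordinate free averages it out. -/
theorem IsContrast.boxMean_eq_zero {S : Set ι} {p : ∀ k, D k → ℝ} (hp : IsContrast S p)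
    {E : ∀ k, D k → Prop} {k : ι} (hk : k ∈ S) (hE : ∀ x, E k x) : boxMean p E = 0 := by
  refine Finset.prod_eq_zero (Finset.mem_univ k) ?_
  simp only [ind_true (hE _), mul_one, hp.sum_eq_zero k hk, zero_div]

theorem boxMean_one_true [∀ k, Nonempty (D k)] :
    boxMean (D := D) (fun _ _ => 1) (fun _ _ => True) = 1 := by
  refine Finset.prod_eq_one fun k _ => ?_
  have : (Fintype.card (D k) : ℝ) ≠ 0 := by simp
  simp [ind, this]

theorem IsContrast.boxMean_and_of_subset [∀ k, Nonempty (D k)] {S A B : Set ι}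
    {p : ∀ k, D k → ℝ} (hp : ∀ k, k ∉ S → ∀ x, p k x = 1) (hAB : Disjoint A B) (hSA : S ⊆ A)
    {E F : ∀ k, D k → Prop} (hE : ∀ k, k ∉ A → ∀ x, E k x) (hF : ∀ k, k ∉ B → ∀ x, F k x) :
    boxMean p (fun k x => E k x ∧ F k x) = boxMean p E * boxMean (fun _ _ => 1) F := by
  unfold boxMean
  rw [← Finset.prod_mul_distrib]
  refine Finset.prod_congr rfl fun k _ => ?_
  have hcard : (Fintype.card (D k) : ℝ) ≠ 0 := by simp
  by_cases hk : k ∈ A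
  · have hkB : k ∉ B := fun h => hAB.le_bot ⟨hk, h⟩
    simp [hF k hkB, ind_true trivial, hcard]
  · have hkS : k ∉ S := fun h => hk (hSA h)
    simp [hE k hk, hp k hkS, ind_true trivial, hcard]

/-- A product rule. If `S` lies in one of `A`, `B`, the other event leaves a coordinate of `S` free
and one summand dies. Otherwise some coordinate of `S` is free in both events and everything
vanishes. -/
theorem IsContrast.boxMean_and [∀ k, Nonempty (D k)] {S A B : Set ι}
    {p : ∀ k, D k → ℝ} (hp : IsContrast S p) (hS : S.Nonempty) (hAB : Disjoint A B)
    (hcases : S ⊆ A ∪ B → S ⊆ A ∨ S ⊆ B)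
    {E F : ∀ k, D k → Prop} (hE : ∀ k, k ∉ A → ∀ x, E k x) (hF : ∀ k, k ∉ B → ∀ x, F k x) :
    boxMean p (fun k x => E k x ∧ F k x) =
      boxMean p E * boxMean (fun _ _ => 1) F + boxMean (fun _ _ => 1) E * boxMean p F := by
  obtain ⟨k₀, hk₀⟩ := hS
  by_cases hSA : S ⊆ A
  · rw [boxMean_and_of_subset hp.eq_one hAB hSA hE hF,
      hp.boxMean_eq_zero hk₀ (hF k₀ fun h => hAB.le_bot ⟨hSA hk₀, h⟩), mul_zero, add_zero]
  by_cases hSB : S ⊆ B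
  · have : (fun k x => E k x ∧ F k x) = fun k x => F k x ∧ E k x := by
      funext k x
      exact propext and_comm
    rw [this, boxMean_and_of_subset hp.eq_one hAB.symm hSB hF hE,
      hp.boxMean_eq_zero hk₀ (hE k₀ fun h => hAB.le_bot ⟨h, hSB hk₀⟩)]
    ring
  obtain ⟨k, hk, hkAB⟩ := Set.not_subset.1 fun h => (hcases h).elim hSA hSB
  have h1 := hE k fun h => hkAB (.inl h)
  have h2 := hF k fun h => hkAB (.inr h)
  rw [hp.boxMean_eq_zero hk h1, hp.boxMean_eq_zero hk h2,
    hp.boxMean_eq_zero hk fun x => ⟨h1 x, h2 x⟩]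
  ring

/-- A perturbation of the uniform density. -/
def perturbed (ε : ℝ) (χ φ : ∀ k, D k → ℝ) (u : ∀ k, D k) : ℝ :=
  (1 + ε * (∏ k, χ k (u k) - ∏ k, φ k (u k))) / ∏ k, (Fintype.card (D k) : ℝ)

/-- The mass that the perturbed density gives to a product event. -/
def perturbedMean (ε : ℝ) (χ φ : ∀ k, D k → ℝ) (E : ∀ k, D k → Prop) : ℝ :=
  boxMean (fun _ _ => 1) E + ε * (boxMean χ E - boxMean φ E)

theorem sum_perturbed (ε : ℝ) (χ φ : ∀ k, D k → ℝ) (E : ∀ k, D k → Prop) :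
    ∑ u, perturbed ε χ φ u * ind (∀ k, E k (u k)) = perturbedMean ε χ φ E := by
  unfold perturbedMean
  rw [← sum_box, ← sum_box, ← sum_box, ← Finset.sum_sub_distrib, Finset.mul_sum,
    ← Finset.sum_add_distrib]
  refine Finset.sum_congr rfl fun u _ => ?_
  unfold perturbed
  rw [Finset.prod_const_one]
  ring

theorem perturbedMean_true [∀ k, Nonempty (D k)] (ε : ℝ) {χ φ : ∀ k, D k → ℝ} {S S' : Set ι}
    (hχ : IsContrast S χ) (hφ : IsContrast S' φ) (hS : S.Nonempty) (hSS' : S ⊆ S') :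
    perturbedMean ε χ φ (fun _ _ => True) = 1 := by
  obtain ⟨k, hk⟩ := hS
  unfold perturbedMean
  rw [boxMean_one_true, hχ.boxMean_eq_zero hk fun _ => trivial,
    hφ.boxMean_eq_zero (hSS' hk) fun _ => trivial]
  ring

/-- The first-order terms in `ε` match by the product rule. The second-order term is zero: a
coordinate of `S`, which also lies in `S'`, is free in `E` or in `F`, and that event has zero mean
under both contrasts. -/
theorem perturbedMean_and [∀ k, Nonempty (D k)] (ε : ℝ) {χ φ : ∀ k, D k → ℝ} {S S' A B : Set ι}
    (hχ : IsContrast S χ) (hφ : IsContrast S' φ) (hS : S.Nonempty) (hSS' : S ⊆ S')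
    (hAB : Disjoint A B) (hcases : S ⊆ A ∪ B → S ⊆ A ∨ S ⊆ B)
    (hcases' : S' ⊆ A ∪ B → S' ⊆ A ∨ S' ⊆ B)
    {E F : ∀ k, D k → Prop} (hE : ∀ k, k ∉ A → ∀ x, E k x) (hF : ∀ k, k ∉ B → ∀ x, F k x) :
    perturbedMean ε χ φ (fun k x => E k x ∧ F k x) =
      perturbedMean ε χ φ E * perturbedMean ε χ φ F := by
  obtain ⟨k, hk⟩ := id hS
  have hcross : (boxMean χ E = 0 ∧ boxMean φ E = 0) ∨ (boxMean χ F = 0 ∧ boxMean φ F = 0) := by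
    by_cases hkA : k ∈ A
    · have h := hF k fun h => hAB.le_bot ⟨hkA, h⟩
      exact .inr ⟨hχ.boxMean_eq_zero hk h, hφ.boxMean_eq_zero (hSS' hk) h⟩
    · have h := hE k hkA
      exact .inl ⟨hχ.boxMean_eq_zero hk h, hφ.boxMean_eq_zero (hSS' hk) h⟩
  unfold perturbedMean
  rw [IsContrast.boxMean_and_of_subset (S := ∅) (p := fun _ _ => 1) (fun _ _ _ => rfl) hAB
    (Set.empty_subset _) hE hF, hχ.boxMean_and hS hAB hcases hE hF,
    hφ.boxMean_and (hS.mono hSS') hAB hcases' hE hF]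
  rcases hcross with ⟨h1, h2⟩ | ⟨h1, h2⟩ <;> rw [h1, h2] <;> ring

end Box

/-! ### Zero-sum weights on response functions -/

/-- Nowhere vanishing matters because these weights are inverted later; two values are needed to
have mean zero as well. -/
theorem exists_zero_sum_weight (Y : Type) [Fintype Y] [Nontrivial Y] :
    ∃ σ : Y → ℝ, ∑ y, σ y = 0 ∧ ∀ y, σ y ≠ 0 := by
  obtain ⟨y₀⟩ := (inferInstance : Nonempty Y)
  have hcard : (1 : ℝ) < Fintype.card Y := by exact_mod_cast Fintype.one_lt_card
  refine ⟨fun y => if y = y₀ then (Fintype.card Y : ℝ) - 1 else -1, ?_, fun y => ?_⟩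
  · have : ∀ y, (if y = y₀ then (Fintype.card Y : ℝ) - 1 else -1) =
        (if y = y₀ then (Fintype.card Y : ℝ) else 0) - 1 := fun y => by split_ifs <;> ring
    simp only [this, Finset.sum_sub_distrib, Finset.sum_ite_eq', Finset.mem_univ, if_true]
    simp
  · dsimp only
    split_ifs
    · linarith
    · norm_num

section ResponseWeight

variable {X Y : Type} [Fintype X] [Fintype Y]

/-- Finiteness of the set of response functions. -/
@[reducible] def responseFintype (X Y : Type) [Fintype X] [Fintype Y] : Fintype (X → Y) :=
  inferInstance

/-- The weight of a response function `r`. -/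
def responseWeight (σ : Y → ℝ) (κ : X → ℝ) (r : X → Y) : ℝ := ∑ x, σ (r x) * κ x

/-- Under the uniform law the values of `r` at distinct points are independent, so the terms with `x
≠ x₀` average to zero and only the queried point contributes. -/
theorem sum_responseWeight_ind [Nonempty Y] {σ : Y → ℝ} (hσ : ∑ y, σ y = 0) (κ : X → ℝ)
    (x₀ : X) (y₀ : Y) :
    (∑ r : X → Y, responseWeight σ κ r * ind (r x₀ = y₀)) / Fintype.card (X → Y) =
      σ y₀ * κ x₀ / Fintype.card Y := by
  have hcard : (Fintype.card Y : ℝ) ≠ 0 := by simp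
  have hterm : ∀ x, (∑ r : X → Y, σ (r x) / Fintype.card (X → Y) * ind (r x₀ = y₀)) =
      if x = x₀ then σ y₀ / Fintype.card Y else 0 := by
    intro x
    have h := sum_box (D := fun _ : X => Y) (fun x' y => if x' = x then σ y else 1)
      (fun x' y => x' = x₀ → y = y₀)
    have h1 : ∀ r : X → Y, (∏ x', if x' = x then σ (r x') else 1) = σ (r x) := fun r => by
      simp
    have h2 : ∀ r : X → Y, (∀ x', x' = x₀ → r x' = y₀) ↔ r x₀ = y₀ := fun r => by simp
    simp only [h1, h2] at h
    have h3 : ((∏ _k : X, Fintype.card Y : ℕ) : ℝ) = Fintype.card (X → Y) := by simp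
    rw [← h3]
    push_cast
    rw [h]
    unfold boxMean
    split_ifs with hx
    · subst hx
      rw [Finset.prod_eq_single x]
      · simp [ind]
      · intro x' _ hx'
        simp [hx', ind, hcard]
      · simp
    · refine Finset.prod_eq_zero (Finset.mem_univ x) ?_
      simp [hx, ind, hσ]
  calc _ = ∑ x, κ x * ∑ r : X → Y, σ (r x) / Fintype.card (X → Y) * ind (r x₀ = y₀) := by
        simp only [responseWeight, Finset.mul_sum, Finset.sum_mul, Finset.sum_div]
        rw [Finset.sum_comm]
        exact Finset.sum_congr rfl fun x _ => Finset.sum_congr rfl fun r _ => by ring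
    _ = _ := by
        simp only [hterm, mul_ite, mul_zero, Finset.sum_ite_eq', Finset.mem_univ, if_true]
        ring

/-- Split by the value of `r` at one point: each part is the same constant times `σ y`. -/
theorem sum_responseWeight [Nonempty X] [Nonempty Y] {σ : Y → ℝ} (hσ : ∑ y, σ y = 0)
    (κ : X → ℝ) : ∑ r : X → Y, responseWeight σ κ r = 0 := by
  obtain ⟨x₀⟩ := (inferInstance : Nonempty X)
  have hcard : (Fintype.card (X → Y) : ℝ) ≠ 0 := by simp
  have h : ∀ r : X → Y, responseWeight σ κ r =
      ∑ y, responseWeight σ κ r * ind (r x₀ = y) := by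
    intro r
    rw [← Finset.mul_sum, Finset.sum_eq_single (r x₀) (fun y _ hy => ind_false hy.symm) (by simp),
      ind_true rfl, mul_one]
  rw [Finset.sum_congr rfl fun r _ => h r, Finset.sum_comm]
  have h2 : ∀ y₀, (∑ r : X → Y, responseWeight σ κ r * ind (r x₀ = y₀)) =
      σ y₀ * (κ x₀ / Fintype.card Y * Fintype.card (X → Y)) := by
    intro y₀
    rw [← div_left_inj' hcard, sum_responseWeight_ind hσ]
    field_simp
  rw [Finset.sum_congr rfl fun y _ => h2 y, ← Finset.sum_mul, hσ, zero_mul]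

theorem sum_ind_response [Nonempty X] [Nonempty Y] (x₀ : X) (y₀ : Y) :
    (∑ r : X → Y, ind (r x₀ = y₀)) / Fintype.card (X → Y) = 1 / Fintype.card Y := by
  have h := sum_box (D := fun _ : X => Y) (fun _ _ => 1) (fun x' y => x' = x₀ → y = y₀)
  have h2 : ∀ r : X → Y, (∀ x', x' = x₀ → r x' = y₀) ↔ r x₀ = y₀ := fun r => by simp
  simp only [h2, Finset.prod_const_one, ← Finset.mul_sum] at h
  have h3 : ((∏ _k : X, Fintype.card Y : ℕ) : ℝ) = Fintype.card (X → Y) := by simp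
  have h4 : (Fintype.card Y : ℝ) ≠ 0 := by simp
  rw [← h3, div_eq_mul_one_div, mul_comm]
  push_cast
  rw [h]
  unfold boxMean
  rw [Finset.prod_eq_single x₀]
  · simp [ind]
  · intro x' _ hx'
    simp [hx', ind, h4]
  · simp

end ResponseWeight

/-- A connected set inside the union of two sets that no edge joins lies in one of them. -/
theorem CausalDiagram.IsCComponent.subset_or_subset {S A B : Finset V} (hS : G.IsCComponent S)
    (hadj : ∀ i ∈ A, ∀ j ∈ B, ¬ G.bidir.Adj i j) (h : S ⊆ A ∪ B) : S ⊆ A ∨ S ⊆ B := by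
  obtain ⟨-, hconn⟩ := CausalDiagram.isCComponent_iff.1 hS
  by_contra! hcon
  obtain ⟨x, hx, hxA⟩ := Finset.not_subset.1 hcon.1
  obtain ⟨y, hy, hyB⟩ := Finset.not_subset.1 hcon.2
  have hyA : y ∈ A := (Finset.mem_union.1 (h hy)).resolve_right hyB
  have key : ∀ z, Relation.ReflTransGen (fun v w => G.bidir.Adj v w ∧ v ∈ S ∧ w ∈ S) y z →
      z ∈ A := by
    intro z hz
    induction hz with
    | refl => exact hyA
    | tail _ hbc ih =>
      exact (Finset.mem_union.1 (h hbc.2.2)).resolve_right fun hB => hadj _ ih _ hB hbc.1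
  exact hxA (key x (hconn y hy x hx))

/-! ### Models with perturbed response functions -/

/-- The domains of the latent variables: a response function for each observable variable, and
a coin for each pair of observable variables. -/
def LatentDom (G : CausalDiagram V) (Val : V → Type) : V ⊕ Sym2 V → Type
  | .inl i => PaVal G Val i → Val i
  | .inr _ => Bool

instance [Fintype V] [∀ v, Fintype (Val v)] (i : V) : Fintype (PaVal G Val i) :=
  Fintype.ofFinite _

instance [Fintype V] [∀ v, Fintype (Val v)] : ∀ k, Fintype (LatentDom G Val k)
  | .inl i => responseFintype (PaVal G Val i) (Val i)
  | .inr _ => inferInstanceAs (Fintype Bool)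

instance [∀ v, Nonempty (Val v)] : ∀ k, Nonempty (LatentDom G Val k)
  | .inl i => inferInstanceAs (Nonempty (PaVal G Val i → Val i))
  | .inr _ => inferInstanceAs (Nonempty Bool)

/-- Contrasts on the response functions of two nested connected sets of variables, and a size for
which they perturb the uniform law to a positive law. -/
structure Perturbation (G : CausalDiagram V) (Val : V → Type) [Fintype V]
    [∀ v, Fintype (Val v)] where
  inner : Finset V
  outer : Finset V
  inner_conn : G.IsCComponent inner
  outer_conn : G.IsCComponent outer
  subset : inner ⊆ outer
  χ : ∀ k, LatentDom G Val k → ℝ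
  φ : ∀ k, LatentDom G Val k → ℝ
  contrast_χ : IsContrast (Sum.inl '' (inner : Set V)) χ
  contrast_φ : IsContrast (Sum.inl '' (outer : Set V)) φ
  ε : ℝ
  pos : ∀ u, 0 < perturbed ε χ φ u

namespace Perturbation

variable [Fintype V] [∀ v, Fintype (Val v)] (p : Perturbation G Val)

theorem inner_nonempty : (Sum.inl '' (p.inner : Set V) : Set (V ⊕ Sym2 V)).Nonempty :=
  ((CausalDiagram.isCComponent_iff.1 p.inner_conn).1.to_set).image _

theorem image_subset :
    (Sum.inl '' (p.inner : Set V) : Set (V ⊕ Sym2 V)) ⊆ Sum.inl '' (p.outer : Set V) :=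
  Set.image_mono p.subset

/-- The probability of a product event. -/
def mean (E : ∀ k, LatentDom G Val k → Prop) : ℝ := perturbedMean p.ε p.χ p.φ E

variable [∀ v, Nonempty (Val v)]

/-- The model in which each observable variable applies its response function, and each
bidirected edge has a coin that is shared by its two ends. -/
def model : SCM G Val where
  Latent := V ⊕ Sym2 V
  Dom := LatentDom G Val
  prob := perturbed p.ε p.χ p.φ
  prob_nonneg u := (p.pos u).le
  prob_sum := by
    have h := sum_perturbed p.ε p.χ p.φ fun _ _ => True
    rw [perturbedMean_true p.ε p.contrast_χ p.contrast_φ p.inner_nonempty p.image_subset] at h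
    simpa [ind] using h
  U i := {k | k = .inl i ∨ ∃ e ∈ G.bidir.edgeSet, i ∈ e ∧ k = .inr e}
  f i u := u (.inl i) (.inl rfl)

theorem pr_model (E : ∀ k, LatentDom G Val k → Prop) :
    p.model.pr (fun u => ∀ k, E k (u k)) = p.mean E := by
  rw [SCM.pr_eq_sum_mul]
  exact sum_perturbed p.ε p.χ p.φ E

theorem pr_model_pos {E : (∀ k, p.model.Dom k) → Prop} {u : ∀ k, p.model.Dom k}
    (hu : E u) : 0 < p.model.pr E := by
  rw [SCM.pr_eq_sum_mul]
  refine Finset.sum_pos' (fun w _ => mul_nonneg (p.pos w).le (ind_nonneg _))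
    ⟨u, Finset.mem_univ _, ?_⟩
  rw [ind_true hu, mul_one]
  exact p.pos u

theorem inl_mem_U {i j : V} : (Sum.inl i : V ⊕ Sym2 V) ∈ p.model.U j ↔ i = j := by
  constructor
  · rintro (h | ⟨e, -, -, h⟩)
    · exact Sum.inl.inj h
    · cases h
  · rintro rfl
    exact .inl rfl

theorem inr_mem_U {e : Sym2 V} {j : V} :
    (Sum.inr e : V ⊕ Sym2 V) ∈ p.model.U j ↔ e ∈ G.bidir.edgeSet ∧ j ∈ e := by
  constructor
  · rintro (h | ⟨e, he, hj, h⟩)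
    · cases h
    · cases h
      exact ⟨he, hj⟩
  · rintro ⟨he, hj⟩
    exact .inr ⟨e, he, hj, rfl⟩

/-- The latent variables of a set of observable variables. -/
def latents (A : Finset V) : Set (V ⊕ Sym2 V) := {k | ∃ i ∈ A, k ∈ p.model.U i}

theorem inl_mem_latents {i : V} {A : Finset V} : Sum.inl i ∈ p.latents A ↔ i ∈ A := by
  constructor
  · rintro ⟨j, hj, hij⟩
    rwa [p.inl_mem_U.1 hij]
  · exact fun h => ⟨i, h, p.inl_mem_U.2 rfl⟩

theorem disjoint_latents {A B : Finset V} (hAB : Disjoint A B)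
    (hadj : ∀ i ∈ A, ∀ j ∈ B, ¬ G.bidir.Adj i j) : Disjoint (p.latents A) (p.latents B) := by
  rw [Set.disjoint_left]
  rintro (i | e) hA hB
  · rw [inl_mem_latents] at hA hB
    exact Finset.disjoint_left.1 hAB hA hB
  · obtain ⟨i, hi, hie⟩ := hA
    obtain ⟨j, hj, hje⟩ := hB
    obtain ⟨he, hie⟩ := p.inr_mem_U.1 hie
    obtain ⟨-, hje⟩ := p.inr_mem_U.1 hje
    have hne : i ≠ j := fun h => Finset.disjoint_left.1 hAB hi (h ▸ hj)
    rw [(Sym2.mem_and_mem_iff hne).1 ⟨hie, hje⟩] at he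
    exact hadj i hi j hj he

theorem latents_cases {S A B : Finset V} (hS : G.IsCComponent S)
    (hadj : ∀ i ∈ A, ∀ j ∈ B, ¬ G.bidir.Adj i j)
    (h : (Sum.inl '' (S : Set V) : Set (V ⊕ Sym2 V)) ⊆ p.latents A ∪ p.latents B) :
    (Sum.inl '' (S : Set V) : Set (V ⊕ Sym2 V)) ⊆ p.latents A ∨
      (Sum.inl '' (S : Set V) : Set (V ⊕ Sym2 V)) ⊆ p.latents B := by
  simp only [Set.image_subset_iff] at h ⊢
  have h' : S ⊆ A ∪ B := by
    intro i hi
    have := h hi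
    simpa only [Set.mem_preimage, Set.mem_union, inl_mem_latents, Finset.mem_union] using this
  refine (hS.subset_or_subset hadj h').imp (fun h i hi => ?_) fun h i hi => ?_
  · exact p.inl_mem_latents.2 (h hi)
  · exact p.inl_mem_latents.2 (h hi)

theorem pr_agree (A : Finset V) (u : ∀ k, p.model.Dom k) :
    p.model.pr (p.model.Agree A u) = p.mean fun k x => k ∈ p.latents A → u k = x := by
  rw [← p.pr_model]
  refine p.model.pr_congr fun w => ?_
  exact ⟨fun h k ⟨i, hi, hk⟩ => h i hi k hk, fun h i hi k hk => h k ⟨i, hi, hk⟩⟩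

theorem induces_model : p.model.Induces := by
  constructor
  · intro i j hij hind
    -- Dependence across an edge: one end seeing its coin true and the other seeing it false have
    -- positive probabilities, but are incompatible. The response functions play no role here.
    let coin : Bool → ∀ k, LatentDom G Val k := fun b k => match k with
      | .inl i => (Classical.arbitrary (PaVal G Val i → Val i) : PaVal G Val i → Val i)
      | .inr _ => b
    have h := hind (coin true) (coin false)
    have h1 := p.pr_model_pos (E := p.model.Agree {i} (coin true)) (u := coin true)
      fun _ _ _ _ => rfl
    have h2 := p.pr_model_pos (E := p.model.Agree {j} (coin false)) (u := coin false)
      fun _ _ _ _ => rfl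
    refine (mul_pos h1 h2).ne' (h.symm.trans ?_)
    rw [SCM.pr_eq_sum_mul]
    refine Finset.sum_eq_zero fun w _ => ?_
    rw [ind_false, mul_zero]
    rintro ⟨hi, hj⟩
    have h3 := hi i (by simp) (Sum.inr s(i, j)) (p.inr_mem_U.2 ⟨hij, by simp⟩)
    have h4 := hj j (by simp) (Sum.inr s(i, j)) (p.inr_mem_U.2 ⟨hij, by simp⟩)
    have h5 : (true : Bool) = false := h3.trans h4.symm
    cases h5
  · intro A B hAB hadj u v
    have h : p.model.pr (fun w => p.model.Agree A u w ∧ p.model.Agree B v w) =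
        p.mean fun k x => (k ∈ p.latents A → u k = x) ∧ (k ∈ p.latents B → v k = x) := by
      rw [← p.pr_model]
      refine p.model.pr_congr fun w => ?_
      exact ⟨fun h k => ⟨fun ⟨i, hi, hk⟩ => h.1 i hi k hk, fun ⟨i, hi, hk⟩ => h.2 i hi k hk⟩,
        fun h => ⟨fun i hi k hk => (h k).1 ⟨i, hi, hk⟩, fun i hi k hk => (h k).2 ⟨i, hi, hk⟩⟩⟩
    refine h.trans (Eq.trans ?_ (congrArg₂ _ (p.pr_agree A u) (p.pr_agree B v)).symm)
    exact perturbedMean_and p.ε p.contrast_χ p.contrast_φ p.inner_nonempty p.image_subset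
      (p.disjoint_latents hAB hadj) (p.latents_cases p.inner_conn hadj)
      (p.latents_cases p.outer_conn hadj) (fun k hk x h => absurd h hk)
      fun k hk x h => absurd h hk

/-- The density is positive everywhere, and a consistent event is realized by response functions
that interpolate its terms. -/
theorem positive_model : p.model.Positive := by
  intro W hW
  have hr : ∀ (i : V) (pa : PaVal G Val i), ∃ x : Val i, ∀ x', (⟨i, pa, x'⟩ : Term G Val) ∈ W →
      x = x' := by
    intro i pa
    by_cases h : ∃ x, (⟨i, pa, x⟩ : Term G Val) ∈ W
    · obtain ⟨x, hx⟩ := h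
      exact ⟨x, fun x' hx' => hW i pa x x' hx hx'⟩
    · exact ⟨Classical.arbitrary _, fun x' hx' => absurd ⟨x', hx'⟩ h⟩
  choose r hr using hr
  let u : ∀ k, LatentDom G Val k := fun k => match k with
    | .inl i => r i
    | .inr _ => true
  refine p.pr_model_pos (u := u) fun a ha => ?_
  exact (Term.responseAt_eq a p.model u).trans (hr a.var a.sub a.val ha)

/-- The event that `s` solves the equations of the variables in `W`. -/
def solves (π : ∀ v, (∀ w, Val w) → PaVal G Val v) (W : Finset V) (s : ∀ w, Val w) :
    ∀ k, LatentDom G Val k → Prop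
  | .inl i, r => i ∈ W → r (π i s) = s i
  | .inr _, _ => True

theorem qFactor_model (π : ∀ v, (∀ w, Val w) → PaVal G Val v) (W : Finset V) (s : ∀ w, Val w) :
    p.model.qFactor π W s = p.mean (solves π W s) := by
  rw [← p.pr_model]
  refine p.model.pr_congr fun u => ?_
  constructor
  · rintro h (i | e)
    · exact h i
    · trivial
  · exact fun h i => h (.inl i)

end Perturbation

/-! ### Contrasts of response functions -/

section Weights

variable [Fintype V] [∀ v, Fintype (Val v)]

/-- The weights `σ i (r pa) * κ i pa`, summed over `pa`, of the response functions `r` of the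
variables `i ∈ S`. -/
def contrast (S : Finset V) (σ : ∀ i, Val i → ℝ) (κ : ∀ i, PaVal G Val i → ℝ) :
    ∀ k, LatentDom G Val k → ℝ
  | .inl i, r => if i ∈ S then responseWeight (σ i) (κ i) r else 1
  | .inr _, _ => 1

variable [∀ v, Nonempty (Val v)]

theorem isContrast_contrast (S : Finset V) {σ : ∀ i, Val i → ℝ} (hσ : ∀ i, ∑ y, σ i y = 0)
    (κ : ∀ i, PaVal G Val i → ℝ) :
    IsContrast (Sum.inl '' (S : Set V)) (contrast S σ κ) := by
  constructor
  · rintro _ ⟨i, hi, rfl⟩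
    have hi : i ∈ S := hi
    have h : ∀ r, contrast S σ κ (Sum.inl i) r = responseWeight (σ i) (κ i) r :=
      fun r => if_pos hi
    simp only [h]
    exact sum_responseWeight (hσ i) (κ i)
  · rintro (i | e) hk x
    · have hi : i ∉ S := fun h => hk ⟨i, h, rfl⟩
      simp only [contrast, if_neg hi]
    · rfl

/-- Each equation in `W` costs `1 / card`, and on `S` it evaluates the weight at the queried inputs
and value. This makes the perturbation explicit on the input distribution. -/
theorem boxMean_contrast {S W : Finset V} (hSW : S ⊆ W) {σ : ∀ i, Val i → ℝ}
    (hσ : ∀ i, ∑ y, σ i y = 0) (κ : ∀ i, PaVal G Val i → ℝ)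
    (π : ∀ v, (∀ w, Val w) → PaVal G Val v) (s : ∀ w, Val w) :
    boxMean (contrast S σ κ) (Perturbation.solves π W s) =
      (∏ i ∈ S, σ i (s i) * κ i (π i s)) * ∏ i ∈ W, 1 / (Fintype.card (Val i) : ℝ) := by
  unfold boxMean
  rw [Fintype.prod_sum_type]
  have hr : ∀ e : Sym2 V, (∑ x, contrast S σ κ (Sum.inr e) x *
      ind (Perturbation.solves π W s (Sum.inr e) x)) /
        (Fintype.card (LatentDom G Val (Sum.inr e)) : ℝ) = 1 := by
    intro e
    have hcard : (Fintype.card (LatentDom G Val (Sum.inr e)) : ℝ) ≠ 0 := by simp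
    simp [contrast, Perturbation.solves, ind, hcard]
  have hl : ∀ i : V, (∑ x, contrast S σ κ (Sum.inl i) x *
      ind (Perturbation.solves π W s (Sum.inl i) x)) /
        (Fintype.card (LatentDom G Val (Sum.inl i)) : ℝ) =
      (if i ∈ S then σ i (s i) * κ i (π i s) else 1) *
        (if i ∈ W then 1 / (Fintype.card (Val i) : ℝ) else 1) := by
    intro i
    by_cases hiS : i ∈ S
    · have hiW := hSW hiS
      have h1 : ∀ r, contrast S σ κ (Sum.inl i) r = responseWeight (σ i) (κ i) r :=
        fun r => if_pos hiS
      have h2 : ∀ r, Perturbation.solves π W s (Sum.inl i) r ↔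
          (r : PaVal G Val i → Val i) (π i s) = s i := fun r => forall_prop_of_true hiW
      rw [if_pos hiS, if_pos hiW, mul_one_div]
      simp only [h1, h2]
      exact sum_responseWeight_ind (hσ i) (κ i) (π i s) (s i)
    · have h1 : ∀ r, contrast S σ κ (Sum.inl i) r = 1 := fun r => if_neg hiS
      rw [if_neg hiS, one_mul]
      by_cases hiW : i ∈ W
      · have h2 : ∀ r, Perturbation.solves π W s (Sum.inl i) r ↔
            (r : PaVal G Val i → Val i) (π i s) = s i := fun r => forall_prop_of_true hiW
        rw [if_pos hiW]
        simp only [h1, h2, one_mul]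
        exact sum_ind_response (π i s) (s i)
      · have h2 : ∀ r, Perturbation.solves π W s (Sum.inl i) r := fun r h => absurd h hiW
        have hcard : (Fintype.card (LatentDom G Val (Sum.inl i)) : ℝ) ≠ 0 := by simp
        rw [if_neg hiW]
        simp [h1, ind_true (h2 _), hcard]
  rw [Finset.prod_congr rfl fun i _ => hl i, Finset.prod_congr rfl fun e _ => hr e,
    Finset.prod_const_one, mul_one, Finset.prod_mul_distrib, Finset.prod_ite_mem,
    Finset.prod_ite_mem, Finset.univ_inter, Finset.univ_inter]

/-- Small perturbations are positive. -/
theorem exists_perturbed_pos (χ φ : ∀ k, LatentDom G Val k → ℝ) :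
    ∃ ε : ℝ, ε ≠ 0 ∧ ∀ u, 0 < perturbed ε χ φ u := by
  set g : (∀ k, LatentDom G Val k) → ℝ := fun u => ∏ k, χ k (u k) - ∏ k, φ k (u k)
  set K : ℝ := ∑ u, |g u|
  have hK0 : 0 ≤ K := Finset.sum_nonneg fun u _ => abs_nonneg _
  refine ⟨1 / (K + 1), by positivity, fun u => div_pos ?_ ?_⟩
  · have h1 : |g u| ≤ K := Finset.single_le_sum (f := fun u => |g u|)
      (fun _ _ => abs_nonneg _) (Finset.mem_univ u)
    have h2 : -K ≤ g u := (abs_le.1 h1).1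
    change 0 < 1 + 1 / (K + 1) * g u
    have h3 : 1 + 1 / (K + 1) * g u = (K + 1 + g u) / (K + 1) := by field_simp
    rw [h3]
    exact div_pos (by linarith) (by linarith)
  · exact Finset.prod_pos fun k _ => by exact_mod_cast Fintype.card_pos

end Weights

/-! ### Completeness -/

/-- A connected event that contains `C` properly, and whose terms outside `C` are all chained to
other terms, makes `C` unidentifiable. -/
theorem not_identifiable [Fintype V] [∀ v, Fintype (Val v)] [∀ v, Nontrivial (Val v)]
    {T T' C : Finset (Term G Val)} (hT : AtMostOnce T) (hT'T : T' ⊆ T) (hCT' : C ⊆ T')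
    (hT'conn : G.IsCComponent (vars T')) (hCconn : G.IsCComponent (vars C)) (hne : T' ≠ C)
    (hch : ∀ a ∈ T', a ∉ C → ∃ b ∈ T', Chained a b) : ¬ Identifiable T C := by
  obtain ⟨co⟩ := hT.nonempty_coords
  have hchild : ∀ j : V, ∃ i, j ∈ vars T' \ vars C → i ∈ vars T' ∧ co.Reads j i := by
    intro j
    by_cases hj : j ∈ vars T' \ vars C
    · obtain ⟨hj, hjC⟩ := Finset.mem_sdiff.1 hj
      obtain ⟨a, ha, rfl⟩ := mem_vars.1 hj
      obtain ⟨b, hb, hab⟩ := hch a ha fun h => hjC (var_mem_vars h)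
      exact ⟨b.var, fun _ => ⟨var_mem_vars hb, (co.chained_iff (hT'T ha) (hT'T hb)).1 hab⟩⟩
    · exact ⟨j, fun h => absurd h hj⟩
  choose ch hchild using hchild
  choose σ hσ0 hσ using fun v : V => exists_zero_sum_weight (Val v)
  -- The child `i` carries the inverse weights of the variables `j` outside `C` that chose it,
  -- computed from its argument `pa`. For such `j` the edge to `i` exists, so the default `1` never
  -- enters.
  let κ : ∀ i, PaVal G Val i → ℝ := fun i pa =>
    ∏ j ∈ vars T' \ vars C with ch j = i, if h : G.dir j i then (σ j (pa j h))⁻¹ else 1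
  have hκ : ∀ s, ∏ i ∈ vars T', κ i (co.pa i s) = ∏ j ∈ vars T' \ vars C, (σ j (s j))⁻¹ := by
    intro s
    rw [← Finset.prod_fiberwise_of_maps_to (g := ch) (t := vars T') fun j hj => (hchild j hj).1]
    refine Finset.prod_congr rfl fun i _ => Finset.prod_congr rfl fun j hj => ?_
    obtain ⟨hjT, rfl⟩ := Finset.mem_filter.1 hj
    have hread := (hchild j hjT).2
    rw [dif_pos hread.dir, co.pa_of_reads hread]
  let χ := contrast (G := G) (vars C) σ fun _ _ => 1
  let φ := contrast (G := G) (vars T') σ κ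
  obtain ⟨ε, hε, hpos⟩ := exists_perturbed_pos χ φ
  let p : Perturbation G Val := ⟨vars C, vars T', hCconn, hT'conn, vars_mono hCT', χ, φ,
    isContrast_contrast _ hσ0 _, isContrast_contrast _ hσ0 _, ε, hpos⟩
  -- The comparison model has the uniform law.
  let p₀ : Perturbation G Val := { p with
    ε := 0
    pos := fun u => by
      simp only [perturbed, zero_mul, add_zero]
      exact div_pos one_pos (Finset.prod_pos fun k _ => by exact_mod_cast Fintype.card_pos) }
  have hagree : ∀ s, boxMean χ (Perturbation.solves co.pa (vars T) s) =
      boxMean φ (Perturbation.solves co.pa (vars T) s) := by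
    intro s
    rw [boxMean_contrast (vars_mono (hCT'.trans hT'T)) hσ0,
      boxMean_contrast (vars_mono hT'T) hσ0]
    congr 1
    simp only [mul_one]
    have hcancel : (∏ j ∈ vars T' \ vars C, σ j (s j)) *
        ∏ j ∈ vars T' \ vars C, (σ j (s j))⁻¹ = 1 := by
      rw [← Finset.prod_mul_distrib]
      exact Finset.prod_eq_one fun j _ => mul_inv_cancel₀ (hσ j _)
    rw [Finset.prod_mul_distrib, hκ,
      ← Finset.prod_sdiff (f := fun i => σ i (s i)) (vars_mono hCT'), mul_right_comm, hcancel,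
      one_mul]
  intro hid
  have h := hid p.model p₀.model p.induces_model p₀.induces_model p.positive_model
    p₀.positive_model (by
      funext s
      rw [co.ctfFamily_eq, co.ctfFamily_eq, p.qFactor_model, p₀.qFactor_model]
      change boxMean _ _ + ε * (boxMean χ _ - boxMean φ _) =
        boxMean _ _ + 0 * (boxMean χ _ - boxMean φ _)
      rw [hagree, sub_self, mul_zero, zero_mul])
  rw [co.ctfFactor_eq _ (hCT'.trans hT'T), co.ctfFactor_eq _ (hCT'.trans hT'T),
    p.qFactor_model, p₀.qFactor_model] at h
  change boxMean _ _ + ε * (boxMean χ _ - boxMean φ _) =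
    boxMean _ _ + 0 * (boxMean χ _ - boxMean φ _) at h
  obtain ⟨a, ha, haC⟩ := Finset.exists_of_ssubset (hCT'.ssubset_of_ne hne.symm)
  -- The target event leaves the response function of a variable of `T'` outside `C` free.
  have hφ : boxMean φ (Perturbation.solves co.pa (vars C) co.val) = 0 := by
    refine p.contrast_φ.boxMean_eq_zero (k := .inl a.var) ⟨a.var, var_mem_vars ha, rfl⟩ ?_
    intro x hx
    exact absurd (((hT.mono hT'T).var_mem_vars_iff hCT' ha).1 hx) haC
  rw [hφ, boxMean_contrast subset_rfl hσ0, zero_mul, sub_zero, add_right_inj] at h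
  refine mul_ne_zero hε (mul_ne_zero ?_ ?_) h
  · exact Finset.prod_ne_zero_iff.2 fun i _ => by simpa using hσ i _
  · exact Finset.prod_ne_zero_iff.2 fun i _ => by simp

end CtfId

end

/-! ### Combination of soundness, hedges and completeness. -/

theorem mainTheorem6 {V : Type} [Fintype V] (G : CtfId.CausalDiagram V)
    (Val : V → Type) [∀ v, Fintype (Val v)] [∀ v, Nontrivial (Val v)]
    (T C : Finset (CtfId.Term G Val))
    (hT_once : CtfId.AtMostOnce T)
    (hT_comp : G.IsCComponent (CtfId.vars T))
    (hC_comp : G.IsCComponent (CtfId.vars C))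
    (hCT : C ⊆ T)
    (ord : Finset V → V → ℕ) (h_ord : ∀ W, CtfId.IsTopoOrder G W (ord W)) :
    (CtfId.Identifiable T C ↔ ∃ e, CtfId.identifyPlus ord C T .input = some e) ∧
    (∀ e, CtfId.identifyPlus ord C T .input = some e →
      ∀ M : CtfId.SCM G Val, M.Induces → M.Positive →
        ∀ t : ∀ v, Val v, (∀ a ∈ T, t a.var = a.val) →
          e.eval (M.ctfFamily T) t = M.ctfFactor C) ∧
    (CtfId.identifyPlus ord C T .input = none ↔
      ∃ T', CtfId.CallsOn C T T' ∧ ∃ G', CtfId.IsCtfHedge G' T' C) ∧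
    (CtfId.identifyPlus ord C T .input = none ↔
      ∃ T', T' ⊆ T ∧ ∃ G', CtfId.IsCtfHedge G' T' C) := by
  have hsound : ∀ e, CtfId.identifyPlus ord C T .input = some e →
      ∀ M : CtfId.SCM G Val, M.Induces → M.Positive →
        ∀ t : ∀ v, Val v, (∀ a ∈ T, t a.var = a.val) →
          e.eval (M.ctfFamily T) t = M.ctfFactor C := by
    intro e he M hM hpos t ht
    obtain ⟨co⟩ := hT_once.nonempty_coords
    -- Off the variables of `T` the point `t` is arbitrary, so it is itself taken as the coordinate
    -- values.
    let co' : CtfId.Coords T := ⟨co.sub, t, fun b hb => by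
      rw [ht b hb, ← co.sub_eq hb]⟩
    rw [co'.ctfFactor_eq M hCT]
    exact CtfId.identifyPlus_sound hM hpos hT_once co' h_ord T .input e hCT subset_rfl
      (fun s => co'.ctfFamily_eq M s) he t
  -- One failing call yields both the hedge and the two models that refute identifiability.
  have hfail : CtfId.identifyPlus ord C T .input = none →
      ∃ T', CtfId.CallsOn C T T' ∧ T' ⊆ T ∧ (∃ G', CtfId.IsCtfHedge G' T' C) ∧
        ¬ CtfId.Identifiable T C := by
    intro h
    obtain ⟨T', hcall, hne, hhull⟩ := CtfId.exists_call_of_identifyPlus_eq_none T .input h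
    obtain ⟨hCT', hT'T, hconn⟩ := hcall.invariant hCT hC_comp hT_comp
    have hne' : T' ≠ C := fun h => hne (hhull.trans h)
    have hch := fun a ha haC => CtfId.exists_chained_of_hull_eq hCT' hhull (a := a) ha haC
    exact ⟨T', hcall, hT'T, CtfId.exists_isCtfHedge (hT_once.mono hT'T) hCT' hconn hne' hch,
      CtfId.not_identifiable hT_once hT'T hCT' hconn hC_comp hne' hch⟩
  refine ⟨⟨fun hid => ?_, ?_⟩, hsound, ⟨fun h => ?_, ?_⟩, fun h => ?_, ?_⟩
  · by_contra! hno
    obtain ⟨-, -, -, -, hnot⟩ := hfail (Option.eq_none_iff_forall_ne_some.2 hno)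
    exact hnot hid
  · rintro ⟨e, he⟩ M₁ M₂ h₁ h₂ hp₁ hp₂ heq
    obtain ⟨co⟩ := hT_once.nonempty_coords
    have ht : ∀ a ∈ T, co.val a.var = a.val := fun a ha => (co.val_eq ha).symm
    rw [← hsound e he M₁ h₁ hp₁ co.val ht, ← hsound e he M₂ h₂ hp₂ co.val ht, heq]
  · obtain ⟨T', hcall, -, hhedge, -⟩ := hfail h
    exact ⟨T', hcall, hhedge⟩
  · rintro ⟨T', hcall, G', hhedge⟩
    exact hhedge.identifyPlus_eq_none ord T .input (hcall.invariant hCT hC_comp hT_comp).2.1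
  · obtain ⟨T', -, hT'T, hhedge, -⟩ := hfail h
    exact ⟨T', hT'T, hhedge⟩
  · rintro ⟨T', hT'T, G', hhedge⟩
    exact hhedge.identifyPlus_eq_none ord T .input hT'T
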